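/- Write $[\Delta]^d=\{1,\dots,\Delta\}^d$ with the Euclidean distance, and let balls $B(x,r)=\{y\in[\Delta]^d:\|x-y\|_2\le r\}$ be closed balls in the grid. The model of computation is a real RAM: integers (with addition, subtraction and comparison) and reals (with exact arithmetic and comparison) are stored in arrays with indirect addressing, each operation takes one step, rounding a real down to an integer costs a constant plus the bit length of the result, and a sampling algorithm (but not a query algorithm) can draw a uniformly random real in $[0,1]$ in one step. There is an absolute constant $c>0$ such that for every $e\in\mathbb N$ there are a sampling algorithm, a value-query algorithm and a range-query algorithm (independent of all parameters below), and constants $A>0$, $k\in\mathbb N$, for which the following holds. Let $d\ge 1$, $\Delta\ge 2$ be integers, $\Gamma\ge 2\sqrt{2\pi}$ and $\rho>0$ reals, put $P:=A\,(d\log_2\Delta)^k$, and let $\Lambda$ be any natural number with $$\Lambda\;\ge\;2^{c\,d/\Gamma^{2/3}}\cdot P .$$ Then there is a random map $\varphi:[\Delta]^d\to\mathbb Z^{d+1}$ such that, on input $d,\Delta,\Lambda,\Gamma,\rho$, the sampling algorithm always halts within $P$ steps, leaving a memory content that serves as the description of $\varphi$, and, with probability at least $1-\Delta^{-ed}$,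 $\varphi$ is an efficient $(\Gamma,\Lambda,\rho)$-hash, that is: 1. (diameter) $\operatorname{diam}(\varphi^{-1}(z))\le\rho$ for every $z\in\varphi([\Delta]^d)$; 2. (consistency) $|\varphi(B(x,\rho/\Gamma))|\le\Lambda$ for every $x\in[\Delta]^d$; 3. (efficiency) for every $x\in[\Delta]^d$, given the description of $\varphi$ and $x$, the value-query algorithm computes $\varphi(x)$ within $\Lambda\cdot P$ steps, and the range-query algorithm computes within $\Lambda\cdot P$ steps a set $\Phi_x\subseteq\mathbb Z^{d+1}$ with $|\Phi_x|\le\Lambda$ and $$\varphi(B(x,\rho/\Gamma))\;\subseteq\;\Phi_x\cap\varphi([\Delta]^d)\;\subseteq\;\varphi(B(x,2\rho)).$$ -/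

import Mathlib

open MeasureTheory

/-! ### The discrete grid with the Euclidean metric -/

/-- The discrete grid `[Δ]^d = {1, …, Δ}^d`. -/
def Grid (d Δ : ℕ) : Type :=
  {x : Fin d → ℤ // ∀ i, 1 ≤ x i ∧ x i ≤ (Δ : ℤ)}

/-- A grid point as a point of Euclidean space. -/
noncomputable def Grid.pt {d Δ : ℕ} (x : Grid d Δ) : EuclideanSpace ℝ (Fin d) :=
  WithLp.toLp 2 (fun i => ((x.1 i : ℤ) : ℝ))

theorem Grid.pt_injective {d Δ : ℕ} :
    Function.Injective (Grid.pt : Grid d Δ → EuclideanSpace ℝ (Fin d)) := by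
  intro x y h
  apply Subtype.ext
  funext i
  have hi : x.pt i = y.pt i := by rw [h]
  exact_mod_cast (show ((x.1 i : ℤ) : ℝ) = ((y.1 i : ℤ) : ℝ) from hi)

/-- The grid carries the Euclidean distance. -/
noncomputable instance Grid.instMetricSpace (d Δ : ℕ) : MetricSpace (Grid d Δ) :=
  MetricSpace.induced Grid.pt Grid.pt_injective inferInstance

/-- A map `φ` on `[Δ]^d` is a `(Γ, Λ, ρ)`-hash: every bucket has diameter at most `ρ`, and the
ball of radius `ρ / Γ` around any grid point meets at most `Λ` buckets. Balls and buckets are sets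
of grid points. -/
structure IsConsistentHash {d Δ : ℕ} {Φ : Type*} (Γ : ℝ) (Λ : ℕ) (ρ : ℝ)
    (φ : Grid d Δ → Φ) : Prop where
  diameter : ∀ z ∈ Set.range φ, Metric.diam (φ ⁻¹' {z}) ≤ ρ
  consistency : ∀ x : Grid d Δ, (φ '' Metric.closedBall x (ρ / Γ)).encard ≤ (Λ : ℕ∞)

/-! ### A real RAM with a step count

The memory consists of arrays of integers and arrays of reals, zero unless written. The name of the
array is fixed in the instruction, the index is computed. Every integer addition, subtraction,
comparison, every exact real arithmetic operation and comparison, every memory access and every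
draw of a uniformly random real costs one step. There is no integer multiplication, and rounding a
real down costs the bit length of the result, so that large integers cannot be manipulated
for free. -/

namespace RealRAM

/-- Memory, and the stream of random reals that have not been drawn yet. -/
structure State where
  ints : ℕ → ℤ → ℤ
  reals : ℕ → ℤ → ℝ
  tape : ℕ → ℝ

/-- Integer expressions. -/
inductive IExp where
  | lit (n : ℤ)
  | get (a : ℕ) (i : IExp)
  | add (e f : IExp)
  | sub (e f : IExp)

/-- Real expressions. -/
inductive RExp where
  | ofInt (e : IExp)
  | get (a : ℕ) (i : IExp)
  | add (e f : RExp)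
  | sub (e f : RExp)
  | mul (e f : RExp)
  | div (e f : RExp)

/-- Tests. -/
inductive BExp where
  | ile (e f : IExp)
  | rle (e f : RExp)
  | not (b : BExp)
  | and (b c : BExp)

def IExp.eval (s : State) : IExp → ℤ
  | .lit n => n
  | .get a i => s.ints a (i.eval s)
  | .add e f => e.eval s + f.eval s
  | .sub e f => e.eval s - f.eval s

/-- Division by zero returns zero. -/
noncomputable def RExp.eval (s : State) : RExp → ℝ
  | .ofInt e => ((e.eval s : ℤ) : ℝ)
  | .get a i => s.reals a (i.eval s)
  | .add e f => e.eval s + f.eval s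
  | .sub e f => e.eval s - f.eval s
  | .mul e f => e.eval s * f.eval s
  | .div e f => e.eval s / f.eval s

def BExp.eval (s : State) : BExp → Prop
  | .ile e f => e.eval s ≤ f.eval s
  | .rle e f => e.eval s ≤ f.eval s
  | .not b => ¬ b.eval s
  | .and b c => b.eval s ∧ c.eval s

/-- Number of operations performed when evaluating an expression. -/
def IExp.cost : IExp → ℕ
  | .lit _ => 1
  | .get _ i => i.cost + 1
  | .add e f => e.cost + f.cost + 1
  | .sub e f => e.cost + f.cost + 1

def RExp.cost : RExp → ℕ
  | .ofInt e => e.cost + 1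
  | .get _ i => i.cost + 1
  | .add e f => e.cost + f.cost + 1
  | .sub e f => e.cost + f.cost + 1
  | .mul e f => e.cost + f.cost + 1
  | .div e f => e.cost + f.cost + 1

def BExp.cost : BExp → ℕ
  | .ile e f => e.cost + f.cost + 1
  | .rle e f => e.cost + f.cost + 1
  | .not b => b.cost + 1
  | .and b c => b.cost + c.cost + 1

/-- Programs. `setI a i e`, `setR a i e` and `floor a i e` store the value of `e`, respectively its
integer part, at index `i` of array `a`; `rand a i` stores a fresh random real there. -/
inductive Cmd where
  | skip
  | setI (a : ℕ) (i e : IExp)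
  | setR (a : ℕ) (i : IExp) (e : RExp)
  | floor (a : ℕ) (i : IExp) (e : RExp)
  | rand (a : ℕ) (i : IExp)
  | seq (c₁ c₂ : Cmd)
  | ite (b : BExp) (c₁ c₂ : Cmd)
  | loop (b : BExp) (c : Cmd)

def State.setI (s : State) (a : ℕ) (i v : ℤ) : State :=
  { s with ints := Function.update s.ints a (Function.update (s.ints a) i v) }

noncomputable def State.setR (s : State) (a : ℕ) (i : ℤ) (v : ℝ) : State :=
  { s with reals := Function.update s.reals a (Function.update (s.reals a) i v) }

/-- `Exec c s s' t`: started in `s`, the program `c` halts in `s'` after exactly `t` steps. -/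
inductive Exec : Cmd → State → State → ℕ → Prop where
  | skip (s : State) : Exec .skip s s 1
  | setI (s : State) (a : ℕ) (i e : IExp) :
      Exec (.setI a i e) s (s.setI a (i.eval s) (e.eval s)) (i.cost + e.cost + 1)
  | setR (s : State) (a : ℕ) (i : IExp) (e : RExp) :
      Exec (.setR a i e) s (s.setR a (i.eval s) (e.eval s)) (i.cost + e.cost + 1)
  | floor (s : State) (a : ℕ) (i : IExp) (e : RExp) :
      Exec (.floor a i e) s (s.setI a (i.eval s) ⌊e.eval s⌋)
        (i.cost + e.cost + Nat.size ⌊e.eval s⌋.natAbs + 1)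
  | rand (s : State) (a : ℕ) (i : IExp) :
      Exec (.rand a i) s
        { s.setR a (i.eval s) (s.tape 0) with tape := fun n => s.tape (n + 1) } (i.cost + 1)
  | seq {c₁ c₂ : Cmd} {s s' s'' : State} {t₁ t₂ : ℕ}
      (h₁ : Exec c₁ s s' t₁) (h₂ : Exec c₂ s' s'' t₂) : Exec (.seq c₁ c₂) s s'' (t₁ + t₂)
  | iteTrue {b : BExp} {c₁ c₂ : Cmd} {s s' : State} {t : ℕ}
      (hb : b.eval s) (h : Exec c₁ s s' t) : Exec (.ite b c₁ c₂) s s' (b.cost + t + 1)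
  | iteFalse {b : BExp} {c₁ c₂ : Cmd} {s s' : State} {t : ℕ}
      (hb : ¬ b.eval s) (h : Exec c₂ s s' t) : Exec (.ite b c₁ c₂) s s' (b.cost + t + 1)
  | loopDone {b : BExp} {c : Cmd} {s : State}
      (hb : ¬ b.eval s) : Exec (.loop b c) s s (b.cost + 1)
  | loopStep {b : BExp} {c : Cmd} {s s' s'' : State} {t₁ t₂ : ℕ}
      (hb : b.eval s) (h₁ : Exec c s s' t₁) (h₂ : Exec (.loop b c) s' s'' t₂) :
      Exec (.loop b c) s s'' (b.cost + t₁ + t₂ + 1)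

/-! ### Input and output conventions -/

/-- Random tapes: sequences of points of `[0, 1]`. -/
abbrev Tape : Type := ℕ → unitInterval

/-- The entries of the tape are independent and uniform on `[0, 1]`. -/
noncomputable def tapeMeasure : Measure Tape :=
  Measure.infinitePi (fun _ : ℕ => (volume : Measure unitInterval))

/-- Initial state of the sampling program: integer array `0` holds `d, Δ, Λ`, real array `0` holds
`Γ, ρ`. -/
noncomputable def startState (d Δ Λ : ℕ) (Γ ρ : ℝ) (ω : Tape) : State where
  ints a i :=
    if a = 0 then
      if i = 0 then (d : ℤ) else if i = 1 then (Δ : ℤ) else if i = 2 then (Λ : ℤ) else 0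
    else 0
  reals a i := if a = 0 then if i = 0 then Γ else if i = 1 then ρ else 0 else 0
  tape n := (ω n : ℝ)

/-- Initial state of a query: the memory that the sampling program left, with the coordinates of the
query point `x` in integer array `1`. A query has no access to randomness. -/
noncomputable def queryState {d Δ : ℕ} (seed : State) (x : Grid d Δ) : State where
  ints := Function.update seed.ints 1
    (fun j => if h : j.toNat < d then if 0 ≤ j then x.1 ⟨j.toNat, h⟩ else 0 else 0)
  reals := seed.reals
  tape _ := 0

/-- Hash values are vectors of `d + 1` integers; the answer to a value query is read from integer
array `2`. -/
def State.outValue (d : ℕ) (s : State) : Fin (d + 1) → ℤ :=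
  fun j => s.ints 2 ((j : ℕ) : ℤ)

/-- The answer to a range query, a finite set of hash values: the number of listed values is at
index `0` of integer array `3`, and the values are listed one after the other in integer
array `4`. -/
def State.outSet (d : ℕ) (s : State) : Finset (Fin (d + 1) → ℤ) :=
  (Finset.range (s.ints 3 0).toNat).image
    (fun i => fun j : Fin (d + 1) => s.ints 4 ((i * (d + 1) + (j : ℕ) : ℕ) : ℤ))

/-- With the memory contents `seed`, the map `φ` is an efficient `(Γ, Λ, ρ)`-hash, where the program
`evalProg` answers value queries and the program `rangeProg` answers range queries, each within
`T` steps. -/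
structure IsEfficientHash {d Δ : ℕ} (evalProg rangeProg : Cmd) (T : ℝ) (Γ : ℝ) (Λ : ℕ) (ρ : ℝ)
    (seed : State) (φ : Grid d Δ → Fin (d + 1) → ℤ) : Prop extends
    IsConsistentHash Γ Λ ρ φ where
  value_query : ∀ x : Grid d Δ, ∃ (s : State) (t : ℕ),
    Exec evalProg (queryState seed x) s t ∧ (t : ℝ) ≤ T ∧ s.outValue d = φ x
  range_query : ∀ x : Grid d Δ, ∃ (s : State) (t : ℕ),
    Exec rangeProg (queryState seed x) s t ∧ (t : ℝ) ≤ T ∧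
      (s.outSet d).card ≤ Λ ∧
      φ '' Metric.closedBall x (ρ / Γ) ⊆ ↑(s.outSet d) ∩ Set.range φ ∧
      ↑(s.outSet d) ∩ Set.range φ ⊆ φ '' Metric.closedBall x (2 * ρ)

end RealRAM

/-!
The construction uses randomly shifted cubical grids with cells of diameter at most `ρ`. Let
`q = ⌈√d⌉` and measure lengths in units of the cell width `ρ / q`, so that the ball
of radius `ρ / Γ` becomes one of radius `R = q / Γ`. For a uniformly random shift, the expected
number of cells within distance `2 * R` of a fixed point is bounded by an exponential moment: the
number of integer vectors `v` with `∑ D(u i, v i)² ≤ B`, where `D` is the distance from a coordinate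
to a unit cell, is at most `exp (lam * B) * ∏ i, ∑ v, exp (-lam * D(u i, v)²)`
(`searchTime_le_gaussWeight`). Each factor has expectation at most `1 + 2 √(π / lam)`, since
averaging over the shift turns the sum over the cells into a Gaussian integral over the line
(`lintegral_gaussWeight_le`). With `lam = Γ ^ (4 / 3)` the product is `exp (O(d / Γ ^ (2 / 3)))`
(`exp_mul_pow_le`).

To have a bound that holds at all grid points simultaneously, `m = O(d log Δ)` independent shifts
are drawn. A shift is good for a point if the search listing the cells within distance `2 * R` stays
within the budget `Λ / m`, and a point is hashed to its cell in the first shift that is good for it,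
together with the number of that shift. By Markov's inequality applied to a product over all shifts,
a point has no good shift with probability at most `2 ^ (-m)`
(`tapeMeasure_forall_lt_searchTime_le`), and the union bound applies
(`tapeMeasure_exists_forall_not_good_le`).

If some point of the ball of radius `R` around `x` uses shift `j`, then the search at radius `R`
around `x` in shift `j` stays within the budget, because the cells it finds are all within distance
`2 * R` of that point (`searchTime_le_searchTime`). So the union over all shifts of the cells found
within the budgets contains the hash values of the ball, and it has at most `Λ` elements. This set
is the answer to a range query, and it also shows consistency (`isEfficientHash_of_good`).

The cells are listed by backtracking over the coordinates, in a single loop (`step`). Cells at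
distance at least `q` in a single coordinate cannot contribute, so that only `2 * q + 1` candidates
per coordinate are tried, and the number of rounds is at most polynomially larger than the number of
cells. Value and range queries are the same program run at two radii (`scan_runs`).

If `ρ < 1 / 4`, then `ρ` is replaced by `1 / 4`; as distinct grid points have distance at least `1`,
this does not change the meaning of the conditions (`dist_le_of_le_max`), and it bounds the size of
the integers that arise by rounding (`size_floor_le`).
-/

/-! ### Reasoning about programs -/

namespace RealRAM

theorem State.setI_ints (s : State) (a b : ℕ) (i j v : ℤ) :
    (s.setI a i v).ints b j = if b = a ∧ j = i then v else s.ints b j := by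
  by_cases hb : b = a
  · subst hb
    by_cases hj : j = i <;> simp [State.setI, Function.update, hj]
  · simp [State.setI, Function.update, hb]

@[simp] theorem State.setI_reals (s : State) (a : ℕ) (i v : ℤ) :
    (s.setI a i v).reals = s.reals := rfl

@[simp] theorem State.setI_tape (s : State) (a : ℕ) (i v : ℤ) :
    (s.setI a i v).tape = s.tape := rfl

theorem State.setR_reals (s : State) (a b : ℕ) (i j : ℤ) (v : ℝ) :
    (s.setR a i v).reals b j = if b = a ∧ j = i then v else s.reals b j := by
  by_cases hb : b = a
  · subst hb
    by_cases hj : j = i <;> simp [State.setR, Function.update, hj]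
  · simp [State.setR, Function.update, hb]

@[simp] theorem State.setR_ints (s : State) (a : ℕ) (i : ℤ) (v : ℝ) :
    (s.setR a i v).ints = s.ints := rfl

@[simp] theorem State.setR_tape (s : State) (a : ℕ) (i : ℤ) (v : ℝ) :
    (s.setR a i v).tape = s.tape := rfl

/-- Whether a program contains an instruction writing to the integer array `a`. -/
def Cmd.writesI (a : ℕ) : Cmd → Bool
  | .skip => false
  | .setI b _ _ => a == b
  | .setR _ _ _ => false
  | .floor b _ _ => a == b
  | .rand _ _ => false
  | .seq c₁ c₂ => c₁.writesI a || c₂.writesI a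
  | .ite _ c₁ c₂ => c₁.writesI a || c₂.writesI a
  | .loop _ c => c.writesI a

/-- Whether a program contains an instruction writing to the real array `a`. -/
def Cmd.writesR (a : ℕ) : Cmd → Bool
  | .skip => false
  | .setI _ _ _ => false
  | .setR b _ _ => a == b
  | .floor _ _ _ => false
  | .rand b _ => a == b
  | .seq c₁ c₂ => c₁.writesR a || c₂.writesR a
  | .ite _ c₁ c₂ => c₁.writesR a || c₂.writesR a
  | .loop _ c => c.writesR a

/-- Whether a program draws random reals. -/
def Cmd.draws : Cmd → Bool
  | .rand _ _ => true
  | .seq c₁ c₂ => c₁.draws || c₂.draws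
  | .ite _ c₁ c₂ => c₁.draws || c₂.draws
  | .loop _ c => c.draws
  | _ => false

theorem Exec.ints_eq {c : Cmd} {s s' : State} {t : ℕ} (h : Exec c s s' t) {a : ℕ}
    (ha : c.writesI a = false) : s'.ints a = s.ints a := by
  induction h with
  | skip => rfl
  | setI s b i e =>
      funext j
      simp only [Cmd.writesI, beq_eq_false_iff_ne, ne_eq] at ha
      simp [State.setI_ints, ha]
  | setR => rfl
  | floor s b i e =>
      funext j
      simp only [Cmd.writesI, beq_eq_false_iff_ne, ne_eq] at ha
      simp [State.setI_ints, ha]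
  | rand => rfl
  | seq _ _ h₁ h₂ =>
      simp only [Cmd.writesI, Bool.or_eq_false_iff] at ha
      rw [h₂ ha.2, h₁ ha.1]
  | iteTrue _ _ h =>
      simp only [Cmd.writesI, Bool.or_eq_false_iff] at ha
      exact h ha.1
  | iteFalse _ _ h =>
      simp only [Cmd.writesI, Bool.or_eq_false_iff] at ha
      exact h ha.2
  | loopDone => rfl
  | loopStep _ _ _ h₁ h₂ => rw [h₂ ha, h₁ ha]

theorem Exec.reals_eq {c : Cmd} {s s' : State} {t : ℕ} (h : Exec c s s' t) {a : ℕ}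
    (ha : c.writesR a = false) : s'.reals a = s.reals a := by
  induction h with
  | skip => rfl
  | setI => rfl
  | setR s b i e =>
      funext j
      simp only [Cmd.writesR, beq_eq_false_iff_ne, ne_eq] at ha
      simp [State.setR_reals, ha]
  | floor => rfl
  | rand s b i =>
      funext j
      simp only [Cmd.writesR, beq_eq_false_iff_ne, ne_eq] at ha
      simp [State.setR_reals, ha]
  | seq _ _ h₁ h₂ =>
      simp only [Cmd.writesR, Bool.or_eq_false_iff] at ha
      rw [h₂ ha.2, h₁ ha.1]
  | iteTrue _ _ h =>
      simp only [Cmd.writesR, Bool.or_eq_false_iff] at ha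
      exact h ha.1
  | iteFalse _ _ h =>
      simp only [Cmd.writesR, Bool.or_eq_false_iff] at ha
      exact h ha.2
  | loopDone => rfl
  | loopStep _ _ _ h₁ h₂ => rw [h₂ ha, h₁ ha]

theorem Exec.tape_eq {c : Cmd} {s s' : State} {t : ℕ} (h : Exec c s s' t)
    (ha : c.draws = false) : s'.tape = s.tape := by
  induction h with
  | skip | setI | setR | floor | loopDone => rfl
  | rand => simp [Cmd.draws] at ha
  | seq _ _ h₁ h₂ =>
      simp only [Cmd.draws, Bool.or_eq_false_iff] at ha
      rw [h₂ ha.2, h₁ ha.1]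
  | iteTrue _ _ h =>
      simp only [Cmd.draws, Bool.or_eq_false_iff] at ha
      exact h ha.1
  | iteFalse _ _ h =>
      simp only [Cmd.draws, Bool.or_eq_false_iff] at ha
      exact h ha.2
  | loopStep _ _ _ h₁ h₂ => rw [h₂ ha, h₁ ha]

/-- Total correctness with a time bound: started in `s`, the program `c` halts within `T` steps in
a state satisfying `Q`. -/
def Runs (c : Cmd) (s : State) (T : ℕ) (Q : State → Prop) : Prop :=
  ∃ (s' : State) (t : ℕ), Exec c s s' t ∧ t ≤ T ∧ Q s'

/-- The rule of consequence. The execution is available for weakening the postcondition, so that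
facts about arrays to which `c` does not write need not be part of `Q`. -/
theorem Runs.mono {c : Cmd} {s : State} {T T' : ℕ} {Q Q' : State → Prop} (h : Runs c s T Q)
    (hT : T ≤ T') (hQ : ∀ s' t, Exec c s s' t → Q s' → Q' s') : Runs c s T' Q' := by
  obtain ⟨s', t, he, ht, hq⟩ := h
  exact ⟨s', t, he, ht.trans hT, hQ s' t he hq⟩

theorem Runs.seq {c₁ c₂ : Cmd} {s : State} {T₁ T₂ : ℕ} {Q : State → Prop}
    (h : Runs c₁ s T₁ (fun s' => Runs c₂ s' T₂ Q)) : Runs (.seq c₁ c₂) s (T₁ + T₂) Q := by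
  obtain ⟨s', t, he, ht, s'', t', he', ht', hq⟩ := h
  exact ⟨s'', t + t', he.seq he', by omega, hq⟩

theorem Runs.ite {b : BExp} {c₁ c₂ : Cmd} {s : State} {T : ℕ} {Q : State → Prop}
    (h₁ : b.eval s → Runs c₁ s T Q) (h₂ : ¬ b.eval s → Runs c₂ s T Q) :
    Runs (.ite b c₁ c₂) s (b.cost + T + 1) Q := by
  by_cases hb : b.eval s
  · obtain ⟨s', t, he, ht, hq⟩ := h₁ hb
    exact ⟨s', _, .iteTrue hb he, by omega, hq⟩
  · obtain ⟨s', t, he, ht, hq⟩ := h₂ hb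
    exact ⟨s', _, .iteFalse hb he, by omega, hq⟩

/-- A loop whose body is executed exactly `N` times, each time within `C` steps, with an invariant
indexed by the number of completed rounds. -/
theorem Runs.loop {b : BExp} {c : Cmd} {I : ℕ → State → Prop} {C N : ℕ}
    (hstep : ∀ n s, n < N → I n s → b.eval s ∧ Runs c s C (I (n + 1)))
    (hend : ∀ s, I N s → ¬ b.eval s) {s : State} (h0 : I 0 s) :
    Runs (.loop b c) s (N * (b.cost + C + 1) + (b.cost + 1)) (I N) := by
  suffices H : ∀ k n, n + k = N → ∀ s, I n s →
      Runs (.loop b c) s (k * (b.cost + C + 1) + (b.cost + 1)) (I N) from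
    H N 0 (by omega) s h0
  intro k
  induction k with
  | zero =>
      intro n hn s hs
      obtain rfl : n = N := by omega
      exact ⟨s, _, .loopDone (hend s hs), by omega, hs⟩
  | succ k ih =>
      intro n hn s hs
      obtain ⟨hb, s', t, he, ht, hI⟩ := hstep n s (by omega) hs
      obtain ⟨s'', t', he', ht', hI'⟩ := ih (n + 1) (by omega) s' hI
      refine ⟨s'', _, .loopStep hb he he', ?_, hI'⟩
      rw [Nat.add_mul]
      omega

/-- Programs without loops, rounding and random draws. -/
def Cmd.straight : Cmd → Bool
  | .skip => true
  | .setI _ _ _ => true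
  | .setR _ _ _ => true
  | .seq c₁ c₂ => c₁.straight && c₂.straight
  | .ite _ c₁ c₂ => c₁.straight && c₂.straight
  | _ => false

open Classical in
/-- The final state of a straight-line program. -/
noncomputable def Cmd.run : Cmd → State → State
  | .setI a i e, s => s.setI a (i.eval s) (e.eval s)
  | .setR a i e, s => s.setR a (i.eval s) (e.eval s)
  | .seq c₁ c₂, s => c₂.run (c₁.run s)
  | .ite b c₁ c₂, s => if b.eval s then c₁.run s else c₂.run s
  | _, s => s

/-- An upper bound for the running time of a straight-line program. -/
def Cmd.bound : Cmd → ℕ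
  | .skip => 1
  | .setI _ i e => i.cost + e.cost + 1
  | .setR _ i e => i.cost + e.cost + 1
  | .seq c₁ c₂ => c₁.bound + c₂.bound
  | .ite b c₁ c₂ => b.cost + (c₁.bound + c₂.bound) + 1
  | _ => 0

theorem Runs.of_straight {c : Cmd} (hc : c.straight = true) {s : State} {Q : State → Prop}
    (hQ : Q (c.run s)) : Runs c s c.bound Q := by
  suffices H : ∀ (c : Cmd), c.straight = true → ∀ s, ∃ t ≤ c.bound, Exec c s (c.run s) t by
    obtain ⟨t, ht, he⟩ := H c hc s
    exact ⟨_, t, he, ht, hQ⟩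
  intro c hc
  induction c with
  | skip => exact fun s => ⟨_, le_rfl, .skip s⟩
  | setI a i e => exact fun s => ⟨_, le_rfl, .setI s a i e⟩
  | setR a i e => exact fun s => ⟨_, le_rfl, .setR s a i e⟩
  | floor | rand | loop => simp [Cmd.straight] at hc
  | seq c₁ c₂ h₁ h₂ =>
      intro s
      simp only [Cmd.straight, Bool.and_eq_true] at hc
      obtain ⟨t₁, ht₁, e₁⟩ := h₁ hc.1 s
      obtain ⟨t₂, ht₂, e₂⟩ := h₂ hc.2 (c₁.run s)
      exact ⟨_, Nat.add_le_add ht₁ ht₂, e₁.seq e₂⟩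
  | ite b c₁ c₂ h₁ h₂ =>
      intro s
      simp only [Cmd.straight, Bool.and_eq_true] at hc
      by_cases hb : b.eval s
      · obtain ⟨t, ht, e⟩ := h₁ hc.1 s
        refine ⟨b.cost + t + 1, ?_, ?_⟩
        · simp only [Cmd.bound]; omega
        · simpa [Cmd.run, hb] using Exec.iteTrue hb e
      · obtain ⟨t, ht, e⟩ := h₂ hc.2 s
        refine ⟨b.cost + t + 1, ?_, ?_⟩
        · simp only [Cmd.bound]; omega
        · simpa [Cmd.run, hb] using Exec.iteFalse hb e

end RealRAM

/-! ### Listing the cells near a point by backtracking -/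

namespace CellSearch

/-- The distance from the real number `u` to the unit cell `[v, v + 1]`. -/
noncomputable def cellDist (u : ℝ) (v : ℤ) : ℝ :=
  if u ≤ v then v - u else if (v : ℝ) + 1 ≤ u then u - (v + 1) else 0

theorem cellDist_nonneg (u : ℝ) (v : ℤ) : 0 ≤ cellDist u v := by
  unfold cellDist; split_ifs <;> linarith

theorem cellDist_floor (u : ℝ) : cellDist u ⌊u⌋ = 0 := by
  have h1 := Int.floor_le u
  have h2 := Int.lt_floor_add_one u
  unfold cellDist
  split_ifs <;> linarith

theorem cellDist_le_add (u w : ℝ) (v : ℤ) : cellDist w v ≤ cellDist u v + |u - w| := by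
  have h1 := le_abs_self (u - w)
  have h2 := neg_abs_le (u - w)
  unfold cellDist; split_ifs <;> linarith

/-- A cell at distance less than `Q` lies within `Q` cells of the cell containing `u`. -/
theorem mem_window {u : ℝ} {v : ℤ} {Q : ℕ} (h : cellDist u v < Q) :
    ⌊u⌋ - Q ≤ v ∧ v < ⌊u⌋ + Q + 1 := by
  have h1 := Int.floor_le u
  have h2 := Int.lt_floor_add_one u
  unfold cellDist at h
  constructor
  · have : ((⌊u⌋ : ℝ) - Q) < v + 1 := by split_ifs at h <;> linarith
    have : ⌊u⌋ - (Q : ℤ) < v + 1 := by exact_mod_cast this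
    omega
  · have : (v : ℝ) < ⌊u⌋ + Q + 1 := by split_ifs at h <;> linarith
    exact_mod_cast this

/-- The number of rounds that the backtracking search spends below a node at which the cells of the
coordinates before `i` have been chosen, at total squared distance `a`, and those of `r` further
coordinates are still to be chosen. Every coordinate runs through the `2 * Q + 1` cells around the
one containing `u i`, and a branch is cut as soon as the squared distance exceeds `B`. -/
noncomputable def searchTime (Q : ℕ) (B : ℝ) (u : ℕ → ℝ) : ℕ → ℕ → ℝ → ℕ
  | 0, _, _ => 1
  | r + 1, i, a =>
      (∑ o ∈ Finset.range (2 * Q + 1),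
        (1 + if a + cellDist (u i) (⌊u i⌋ - Q + o) ^ 2 ≤ B then
          searchTime Q B u r (i + 1) (a + cellDist (u i) (⌊u i⌋ - Q + o) ^ 2) else 0)) + 1

/-- The memory of the backtracking search. At depth `i + 1` the search is choosing a cell for
coordinate `i`; the next candidate is `next (i + 1)`, and `acc (i + 1)` is the squared distance in
the coordinates before `i`. At depth `d + 1` all coordinates are chosen, and the choice for
coordinate `i` is `next (i + 1) - 1`. The search is over at depth `0`. -/
structure SearchState (d : ℕ) where
  depth : ℕ
  next : ℕ → ℤ
  acc : ℕ → ℝ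
  out : List (Fin (d + 1) → ℤ)

/-- The vector consisting of the cell `v` and the number `j` of the shift. -/
def encode (d : ℕ) (v : ℕ → ℤ) (j : ℤ) : Fin (d + 1) → ℤ :=
  fun t => if (t : ℕ) < d then v t else j

theorem encode_congr {d : ℕ} {v w : ℕ → ℤ} (j : ℤ) (h : ∀ i < d, v i = w i) :
    encode d v j = encode d w j := by
  funext t
  unfold encode
  split_ifs with ht
  · exact h t ht
  · rfl

theorem encode_inj {d : ℕ} {v w : ℕ → ℤ} {j k : ℤ} (h : encode d v j = encode d w k) :
    (∀ i < d, v i = w i) ∧ j = k := by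
  constructor
  · intro i hi
    have := congrFun h ⟨i, by omega⟩
    simpa [encode, hi] using this
  · have := congrFun h (Fin.last d)
    simpa [encode] using this

variable {d : ℕ} (Q : ℕ) (B : ℝ) (u : ℕ → ℝ) (j : ℤ)

/-- One round of the backtracking search. -/
noncomputable def step (σ : SearchState d) : SearchState d :=
  if d < σ.depth then
    { σ with
      depth := d
      out := σ.out ++ [encode d (fun i => σ.next (i + 1) - 1) j] }
  else if σ.next σ.depth ≤ ⌊u (σ.depth - 1)⌋ + Q then
    let a := σ.acc σ.depth + cellDist (u (σ.depth - 1)) (σ.next σ.depth) ^ 2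
    let next := Function.update σ.next σ.depth (σ.next σ.depth + 1)
    if a ≤ B then
      { σ with
        depth := σ.depth + 1
        next := Function.update next (σ.depth + 1) (⌊u σ.depth⌋ - Q)
        acc := Function.update σ.acc (σ.depth + 1) a }
    else { σ with next := next }
  else { σ with depth := σ.depth - 1 }

variable {Q B u j}

theorem mem_out_step {σ : SearchState d} {z : Fin (d + 1) → ℤ} (h : z ∈ σ.out) :
    z ∈ (step Q B u j σ).out := by
  unfold step
  dsimp only
  split_ifs <;> simp [h]

theorem mem_out_iterate {σ : SearchState d} {z : Fin (d + 1) → ℤ} (n : ℕ) (h : z ∈ σ.out) :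
    z ∈ ((step Q B u j)^[n] σ).out := by
  induction n with
  | zero => exact h
  | succ n ih => rw [Function.iterate_succ_apply']; exact mem_out_step ih

theorem length_out_iterate (σ : SearchState d) (n : ℕ) :
    ((step Q B u j)^[n] σ).out.length ≤ σ.out.length + n := by
  induction n with
  | zero => simp
  | succ n ih =>
      rw [Function.iterate_succ_apply']
      set τ := (step Q B u j)^[n] σ
      have : (step Q B u j τ).out.length ≤ τ.out.length + 1 := by
        unfold step
        dsimp only
        split_ifs <;> simp
      omega

/-- The listed vectors are cells at squared distance at most `B`. -/
def OutSound (B : ℝ) (u : ℕ → ℝ) (j : ℤ) (L : List (Fin (d + 1) → ℤ)) : Prop :=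
  ∀ z ∈ L, ∃ v : ℕ → ℤ, z = encode d v j ∧ ∑ i ∈ Finset.range d, cellDist (u i) (v i) ^ 2 ≤ B

/-- The invariant of the search: the accumulated distances belong to the cells chosen so far. The
search adds only vectors at distance at most `B` to the initial list `L₀`. -/
structure Sound (B : ℝ) (u : ℕ → ℝ) (j : ℤ) (L₀ : List (Fin (d + 1) → ℤ))
    (σ : SearchState d) : Prop where
  depth_le : σ.depth ≤ d + 1
  acc_eq : ∀ k < σ.depth, σ.acc (k + 1) =
    ∑ i ∈ Finset.range k, cellDist (u i) (σ.next (i + 1) - 1) ^ 2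
  acc_le : ∀ k < σ.depth, σ.acc (k + 1) ≤ B
  out : ∃ L, σ.out = L₀ ++ L ∧ OutSound B u j L

theorem Sound.step {L₀ : List (Fin (d + 1) → ℤ)} {σ : SearchState d} (h : Sound B u j L₀ σ)
    (hpos : 0 < σ.depth) : Sound B u j L₀ (step Q B u j σ) := by
  obtain ⟨hd, h1, h2, L, hL, hS⟩ := h
  obtain ⟨p, hp⟩ : ∃ p, σ.depth = p + 1 := ⟨σ.depth - 1, by omega⟩
  unfold CellSearch.step
  dsimp only
  split_ifs with c1 c2 c3
  · refine ⟨by simp, fun k hk => h1 k (by simp at hk; omega), fun k hk => h2 k (by simp at hk; omega),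
      L ++ [encode d (fun i => σ.next (i + 1) - 1) j], by simp [hL], ?_⟩
    intro z hz
    rcases List.mem_append.1 hz with hz | hz
    · exact hS z hz
    · refine ⟨_, List.mem_singleton.1 hz, ?_⟩
      rw [← h1 d c1]
      exact h2 d c1
  · have key : ∀ k ≤ p + 1, Function.update σ.acc (σ.depth + 1) (σ.acc σ.depth +
        cellDist (u (σ.depth - 1)) (σ.next σ.depth) ^ 2) (k + 1) =
        ∑ i ∈ Finset.range k, cellDist (u i) (Function.update (Function.update σ.next σ.depth
          (σ.next σ.depth + 1)) (σ.depth + 1) (⌊u σ.depth⌋ - Q) (i + 1) - 1) ^ 2 := by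
      intro k hk
      have hsum : ∀ k ≤ p, ∑ i ∈ Finset.range k, cellDist (u i) (Function.update
          (Function.update σ.next σ.depth (σ.next σ.depth + 1)) (σ.depth + 1)
          (⌊u σ.depth⌋ - Q) (i + 1) - 1) ^ 2 =
          ∑ i ∈ Finset.range k, cellDist (u i) (σ.next (i + 1) - 1) ^ 2 := by
        intro k hk
        refine Finset.sum_congr rfl fun i hi => ?_
        have := Finset.mem_range.1 hi
        rw [Function.update_of_ne (by omega), Function.update_of_ne (by omega)]
      rcases Nat.lt_or_ge p k with h | h
      · obtain rfl : k = p + 1 := by omega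
        rw [Finset.sum_range_succ, hsum p le_rfl, ← h1 p (by omega), hp]
        simp
      · rw [hsum k h, Function.update_of_ne (by omega), h1 k (by omega)]
    refine ⟨by dsimp only; omega, fun k hk => key k (by dsimp only at hk; omega), ?_, L, hL, hS⟩
    intro k hk
    dsimp only at hk ⊢
    rcases Nat.lt_or_ge p k with h | h
    · obtain rfl : k = p + 1 := by omega
      rw [hp] at c3
      simpa [hp] using c3
    · rw [Function.update_of_ne (by omega)]
      exact h2 k (by omega)
  · refine ⟨hd, fun k hk => ?_, h2, L, hL, hS⟩
    dsimp only at hk ⊢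
    rw [h1 k hk]
    refine Finset.sum_congr rfl fun i hi => ?_
    have := Finset.mem_range.1 hi
    rw [Function.update_of_ne (by omega)]
  · exact ⟨by dsimp only; omega, fun k hk => h1 k (by dsimp only at hk; omega),
      fun k hk => h2 k (by dsimp only at hk; omega), L, hL, hS⟩

theorem Sound.iterate {L₀ : List (Fin (d + 1) → ℤ)} {σ : SearchState d} (h : Sound B u j L₀ σ)
    {n : ℕ} (hpos : ∀ k < n, 0 < ((CellSearch.step Q B u j)^[k] σ).depth) :
    Sound B u j L₀ ((CellSearch.step Q B u j)^[n] σ) := by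
  induction n with
  | zero => exact h
  | succ n ih =>
      rw [Function.iterate_succ_apply']
      exact (ih fun k hk => hpos k (by omega)).step (hpos n (by omega))

/-- Exploration of the subtree below the current node: after `n` rounds from `σ`, all of them at
depth above `i`, the search is at depth `i`, the choices and distances above the node are
unchanged, and all vectors that extend the choices made in `σ` and satisfy `P` are listed. -/
structure Explores (Q : ℕ) (B : ℝ) (u : ℕ → ℝ) (j : ℤ) (i : ℕ) (P : (ℕ → ℤ) → Prop) (n : ℕ)
    (σ : SearchState d) : Prop where
  depth_eq : ((step Q B u j)^[n] σ).depth = i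
  lt_depth : ∀ k < n, i < ((step Q B u j)^[k] σ).depth
  next_eq : ∀ k ≤ i, ((step Q B u j)^[n] σ).next k = σ.next k
  acc_eq : ∀ k ≤ i + 1, ((step Q B u j)^[n] σ).acc k = σ.acc k
  complete : ∀ v, (∀ k < i, v k = σ.next (k + 1) - 1) → P v →
    encode d v j ∈ ((step Q B u j)^[n] σ).out

/-- An exploration may be preceded by `n` rounds that stay below depth `i` and keep what is above,
provided that these rounds have listed what the rest does not. -/
theorem Explores.append {i n n' : ℕ} {P P' : (ℕ → ℤ) → Prop} {σ : SearchState d}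
    (h : Explores Q B u j i P n' ((step Q B u j)^[n] σ))
    (hlt : ∀ k < n, i < ((step Q B u j)^[k] σ).depth)
    (hnext : ∀ k ≤ i, ((step Q B u j)^[n] σ).next k = σ.next k)
    (hacc : ∀ k ≤ i + 1, ((step Q B u j)^[n] σ).acc k = σ.acc k)
    (hP : ∀ v, (∀ k < i, v k = σ.next (k + 1) - 1) → P' v →
      P v ∨ encode d v j ∈ ((step Q B u j)^[n] σ).out) :
    Explores Q B u j i P' (n' + n) σ := by
  obtain ⟨h1, h2, h3, h4, h5⟩ := h
  refine ⟨?_, ?_, ?_, ?_, ?_⟩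
  · rw [Function.iterate_add_apply]; exact h1
  · intro k hk
    rcases Nat.lt_or_ge k n with hkn | hkn
    · exact hlt k hkn
    · obtain ⟨k', rfl⟩ := Nat.exists_eq_add_of_le' hkn
      rw [Function.iterate_add_apply]
      exact h2 k' (by omega)
  · intro k hk
    rw [Function.iterate_add_apply, h3 k hk, hnext k hk]
  · intro k hk
    rw [Function.iterate_add_apply, h4 k hk, hacc k hk]
  · intro v hv hPv
    rw [Function.iterate_add_apply]
    rcases hP v hv hPv with hp | hp
    · exact h5 v (fun k hk => by rw [hv k hk, hnext (k + 1) (by omega)]) hp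
    · exact mem_out_iterate _ hp

theorem cellDist_lt_of_sum_le (hB : B < (Q : ℝ) ^ 2) {a : ℝ} (ha : 0 ≤ a) {r i : ℕ} {v : ℕ → ℤ}
    (h : a + ∑ k ∈ Finset.range (r + 1), cellDist (u (i + k)) (v (i + k)) ^ 2 ≤ B) :
    cellDist (u i) (v i) < Q := by
  rw [Finset.sum_range_succ'] at h
  have h0 : 0 ≤ ∑ k ∈ Finset.range r, cellDist (u (i + (k + 1))) (v (i + (k + 1))) ^ 2 :=
    Finset.sum_nonneg fun _ _ => sq_nonneg _
  refine lt_of_pow_lt_pow_left₀ 2 (Nat.cast_nonneg Q) ?_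
  rw [add_zero] at h
  linarith

/-- From a fresh node, the search explores the subtree below it in exactly `searchTime` rounds. -/
theorem exists_explores (hB : B < (Q : ℝ) ^ 2) (r : ℕ) : ∀ (i : ℕ) (σ : SearchState d), i + r = d →
    σ.depth = i + 1 → 0 ≤ σ.acc (i + 1) → (r ≠ 0 → σ.next (i + 1) = ⌊u i⌋ - Q) →
    Explores Q B u j i
      (fun v => σ.acc (i + 1) + ∑ k ∈ Finset.range r, cellDist (u (i + k)) (v (i + k)) ^ 2 ≤ B)
      (searchTime Q B u r i (σ.acc (i + 1))) σ := by
  induction r with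
  | zero =>
      intro i σ hid hdep _ _
      have hstep : (step Q B u j)^[searchTime Q B u 0 i (σ.acc (i + 1))] σ =
          { σ with
            depth := d
            out := σ.out ++ [encode d (fun i => σ.next (i + 1) - 1) j] } := by
        simp only [searchTime, Function.iterate_one, step]
        rw [if_pos (by omega)]
      refine ⟨?_, ?_, ?_, ?_, ?_⟩
      · rw [hstep]; simp; omega
      · intro k hk
        obtain rfl : k = 0 := by simpa [searchTime] using hk
        simp; omega
      · rw [hstep]; simp
      · rw [hstep]; simp
      · intro v hv _
        rw [hstep]
        have : encode d v j = encode d (fun i => σ.next (i + 1) - 1) j :=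
          encode_congr _ fun k hk => hv k (by omega)
        simp [this]
  | succ r ih =>
      intro i σ hid hdep hacc hnext
      -- The candidates for coordinate `i` are processed one by one; `n` of them are left.
      suffices H : ∀ (n : ℕ) (c : ℤ) (σ : SearchState d), c + n = ⌊u i⌋ + Q + 1 →
          σ.depth = i + 1 → 0 ≤ σ.acc (i + 1) → σ.next (i + 1) = c →
          Explores Q B u j i
            (fun v => σ.acc (i + 1) +
              ∑ k ∈ Finset.range (r + 1), cellDist (u (i + k)) (v (i + k)) ^ 2 ≤ B ∧ c ≤ v i)
            ((∑ o ∈ Finset.range n, (1 + if σ.acc (i + 1) + cellDist (u i) (c + o) ^ 2 ≤ B then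
              searchTime Q B u r (i + 1) (σ.acc (i + 1) + cellDist (u i) (c + o) ^ 2) else 0)) + 1)
            σ by
        obtain ⟨h1, h2, h3, h4, h5⟩ := H (2 * Q + 1) (⌊u i⌋ - Q) σ (by push_cast; ring) hdep
          hacc (hnext (by simp))
        exact ⟨h1, h2, h3, h4, fun v hv hP =>
          h5 v hv ⟨hP, (mem_window (cellDist_lt_of_sum_le hB hacc hP)).1⟩⟩
      intro n
      induction n with
      | zero =>
          intro c σ hc hdep hacc hnext
          have hstep : step Q B u j σ = { σ with depth := i } := by
            unfold step
            rw [if_neg (by omega), if_neg (by rw [hdep, hnext]; simp at hc ⊢; omega), hdep]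
            rfl
          simp only [Finset.range_zero, Finset.sum_empty, zero_add]
          refine ⟨by simp [hstep], ?_, by simp [hstep], by simp [hstep], ?_⟩
          · intro k hk
            obtain rfl : k = 0 := by omega
            simp; omega
          · rintro v hv ⟨hP, hcv⟩
            have := (mem_window (cellDist_lt_of_sum_le hB hacc hP)).2
            simp at hc
            omega
      | succ n ihn =>
          intro c σ hc hdep hacc hnext
          push_cast at hc
          rw [Finset.sum_range_succ']
          simp only [Nat.cast_add, Nat.cast_one, Nat.cast_zero, add_zero]
          by_cases hle : σ.acc (i + 1) + cellDist (u i) c ^ 2 ≤ B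
          -- The candidate is accepted, its subtree is explored, and the next candidate follows.
          · set a := σ.acc (i + 1) + cellDist (u i) c ^ 2 with ha
            have hstep : step Q B u j σ =
                { σ with
                  depth := i + 2
                  next := Function.update (Function.update σ.next (i + 1) (c + 1)) (i + 2)
                    (⌊u (i + 1)⌋ - Q)
                  acc := Function.update σ.acc (i + 2) a } := by
              unfold step
              dsimp only
              rw [hdep, Nat.add_sub_cancel, hnext, if_neg (by omega), if_pos (by omega),
                if_pos hle]
            have hdep1 : (step Q B u j σ).depth = i + 1 + 1 := by rw [hstep]
            have hacc1 : (step Q B u j σ).acc (i + 1 + 1) = a := by simp [hstep]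
            have hex := ih (i + 1) (step Q B u j σ) (by omega) hdep1
              (by rw [hacc1]; positivity) (fun _ => by simp [hstep])
            rw [hacc1] at hex
            rw [if_pos hle]
            set t := searchTime Q B u r (i + 1) a
            have hit : (step Q B u j)^[t + 1] σ = (step Q B u j)^[t] (step Q B u j σ) :=
              Function.iterate_succ_apply _ _ _
            have hnext2 : ∀ k ≤ i + 1, ((step Q B u j)^[t + 1] σ).next k =
                if k = i + 1 then c + 1 else σ.next k := by
              intro k hk
              rw [hit, hex.next_eq k hk, hstep]
              simp only [Function.update_apply]
              rw [if_neg (by omega)]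
            have hacc2 : ∀ k ≤ i + 1, ((step Q B u j)^[t + 1] σ).acc k = σ.acc k := by
              intro k hk
              rw [hit, hex.acc_eq k (by omega), hstep]
              simp only [Function.update_apply]
              rw [if_neg (by omega)]
            have hrest := ihn (c + 1) ((step Q B u j)^[t + 1] σ) (by omega)
              (by rw [hit]; exact hex.depth_eq) (by rw [hacc2 _ le_rfl]; exact hacc)
              (by rw [hnext2 _ le_rfl, if_pos rfl])
            have := Explores.append hrest (P' := fun v => σ.acc (i + 1) +
              ∑ k ∈ Finset.range (r + 1), cellDist (u (i + k)) (v (i + k)) ^ 2 ≤ B ∧ c ≤ v i)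
              ?_ ?_ ?_ ?_
            · rw [hacc2 _ le_rfl] at this
              convert this using 1
              have : ∀ o : ℕ, c + 1 + (o : ℤ) = c + (o + 1) := fun o => by ring
              simp only [this]
              ring
            · intro k hk
              rcases k with _ | k
              · simp; omega
              · rw [Function.iterate_succ_apply]
                exact lt_trans (Nat.lt_succ_self i) (hex.lt_depth k (by omega))
            · intro k hk
              rw [hnext2 k (by omega), if_neg (by omega)]
            · exact hacc2
            · rintro v hv ⟨hP, hcv⟩
              rw [hacc2 _ le_rfl]
              rcases eq_or_lt_of_le hcv with hcv | hcv
              · right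
                rw [hit]
                refine hex.complete v ?_ ?_
                · intro k hk
                  rw [hstep]
                  simp only [Function.update_apply]
                  rw [if_neg (by omega)]
                  split_ifs with hki
                  · obtain rfl : k = i := by omega
                    omega
                  · exact hv k (by omega)
                · rw [Finset.sum_range_succ'] at hP
                  rw [ha, hcv]
                  simp only [add_zero] at hP
                  refine le_trans (le_of_eq ?_) hP
                  rw [add_assoc, add_comm (cellDist _ _ ^ 2)]
                  congr 2
                  exact Finset.sum_congr rfl fun k _ => by rw [add_right_comm, add_assoc]
              · exact Or.inl ⟨hP, by omega⟩
          -- The candidate is rejected, and one round is spent on it.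
          · have hstep : step Q B u j σ =
                { σ with next := Function.update σ.next (i + 1) (c + 1) } := by
              unfold step
              dsimp only
              rw [hdep, Nat.add_sub_cancel, hnext, if_neg (by omega), if_pos (by omega),
                if_neg hle]
            have hrest := ihn (c + 1) ((step Q B u j)^[1] σ) (by omega)
              (by simp [hstep, hdep]) (by simpa [hstep] using hacc) (by simp [hstep])
            rw [if_neg hle]
            have hacc2 : ((step Q B u j)^[1] σ).acc = σ.acc := by simp [hstep]
            have := Explores.append hrest (P' := fun v => σ.acc (i + 1) +
              ∑ k ∈ Finset.range (r + 1), cellDist (u (i + k)) (v (i + k)) ^ 2 ≤ B ∧ c ≤ v i)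
              ?_ ?_ ?_ ?_
            · rw [hacc2] at this
              convert this using 1
              have : ∀ o : ℕ, c + 1 + (o : ℤ) = c + (o + 1) := fun o => by ring
              simp only [this]
            · intro k hk
              obtain rfl : k = 0 := by omega
              simp; omega
            · intro k hk
              simp only [Function.iterate_one, hstep, Function.update_apply]
              rw [if_neg (by omega)]
            · intro k _; rw [hacc2]
            · rintro v hv ⟨hP, hcv⟩
              rw [hacc2]
              rcases eq_or_lt_of_le hcv with hcv | hcv
              · refine absurd ?_ hle
                rw [Finset.sum_range_succ'] at hP
                rw [hcv]
                have : 0 ≤ ∑ k ∈ Finset.range r,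
                  cellDist (u (i + (k + 1))) (v (i + (k + 1))) ^ 2 :=
                  Finset.sum_nonneg fun _ _ => sq_nonneg _
                simp only [add_zero] at hP
                linarith
              · exact Or.inl ⟨hP, by omega⟩

/-! ### The search time -/

/-- Two sums over windows of the same length are compared termwise if all nonzero terms of the first
one lie in the window of the second one. -/
theorem sum_window_le {F G : ℤ → ℕ} {c c' : ℤ} {N : ℕ}
    (h : ∀ v, F v ≠ 0 → F v ≤ G v ∧ c' ≤ v ∧ v < c' + N) :
    ∑ o ∈ Finset.range N, F (c + o) ≤ ∑ o ∈ Finset.range N, G (c' + o) := by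
  have conv : ∀ (H : ℤ → ℕ) (c : ℤ),
      ∑ o ∈ Finset.range N, H (c + o) = ∑ v ∈ Finset.Ico c (c + N), H v := by
    intro H c
    refine Finset.sum_bij (fun o _ => c + (o : ℤ)) ?_ ?_ ?_ ?_
    · intro o ho
      have := Finset.mem_range.1 ho
      exact Finset.mem_Ico.2 ⟨by omega, by omega⟩
    · intro o _ o' _ h
      simpa using h
    · intro v hv
      have := Finset.mem_Ico.1 hv
      exact ⟨(v - c).toNat, Finset.mem_range.2 (by omega), by omega⟩
    · exact fun _ _ => rfl
  rw [conv, conv, ← Finset.sum_filter_ne_zero]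
  refine (Finset.sum_le_sum fun v hv => (h v (Finset.mem_filter.1 hv).2).1).trans
    (Finset.sum_le_sum_of_subset fun v hv => ?_)
  exact Finset.mem_Ico.2 (h v (Finset.mem_filter.1 hv).2).2

/-- The triangle inequality of the Euclidean plane. -/
theorem sqrt_add_sq_le {a b E x y e : ℝ} (ha : 0 ≤ a) (hb : 0 ≤ b) (hE : 0 ≤ E)
    (hy : 0 ≤ y) (hab : √b ≤ √a + √E) (hxy : y ≤ x + e) :
    √(b + y ^ 2) ≤ √(a + x ^ 2) + √(E + e ^ 2) := by
  rw [Real.sqrt_le_left (by positivity)]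
  have h1 : √a * √E + x * e ≤ √(a + x ^ 2) * √(E + e ^ 2) := by
    rw [← Real.sqrt_mul (show 0 ≤ a + x ^ 2 by positivity)]
    apply Real.le_sqrt_of_sq_le
    nlinarith [sq_nonneg (√a * e - √E * x), Real.sq_sqrt ha, Real.sq_sqrt hE]
  have h2 : b ≤ (√a + √E) ^ 2 := by
    rw [← Real.sq_sqrt hb]
    exact pow_le_pow_left₀ (Real.sqrt_nonneg b) hab 2
  have h3 : y ^ 2 ≤ (x + e) ^ 2 := pow_le_pow_left₀ hy hxy 2
  have h4 := Real.sq_sqrt (show 0 ≤ a + x ^ 2 by positivity)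
  have h5 := Real.sq_sqrt (show 0 ≤ E + e ^ 2 by positivity)
  nlinarith [Real.sq_sqrt ha, Real.sq_sqrt hE]

/-- The cells within distance `R` of a point are within distance `2 * R` of every point at distance
at most `R` from it, so that the search around the latter takes at least as long. -/
theorem searchTime_le_searchTime {Q d : ℕ} {R : ℝ} (hR : 0 ≤ R) (hQ : 2 * R < Q) {u w : ℕ → ℝ}
    (huw : ∑ k ∈ Finset.range d, (u k - w k) ^ 2 ≤ R ^ 2) (r : ℕ) :
    ∀ (i : ℕ) (a b : ℝ), i + r ≤ d → 0 ≤ a → 0 ≤ b →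
      √b ≤ √a + √(∑ k ∈ Finset.range i, (u k - w k) ^ 2) →
      searchTime Q (R ^ 2) u r i a ≤ searchTime Q ((2 * R) ^ 2) w r i b := by
  induction r with
  | zero => intros; simp [searchTime]
  | succ r ih =>
      intro i a b hi ha hb hab
      have key : ∀ v, √(b + cellDist (w i) v ^ 2) ≤
          √(a + cellDist (u i) v ^ 2) + √(∑ k ∈ Finset.range (i + 1), (u k - w k) ^ 2) := by
        intro v
        rw [Finset.sum_range_succ, ← sq_abs (u i - w i)]
        exact sqrt_add_sq_le ha hb (Finset.sum_nonneg fun _ _ => sq_nonneg _)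
          (cellDist_nonneg _ _) hab (cellDist_le_add _ _ _)
      have hsum : √(∑ k ∈ Finset.range (i + 1), (u k - w k) ^ 2) ≤ R := by
        rw [Real.sqrt_le_left hR]
        refine le_trans (Finset.sum_le_sum_of_subset_of_nonneg ?_ fun _ _ _ => sq_nonneg _) huw
        exact Finset.range_subset_range.2 (by omega)
      have hok : ∀ v, a + cellDist (u i) v ^ 2 ≤ R ^ 2 →
          b + cellDist (w i) v ^ 2 ≤ (2 * R) ^ 2 := by
        intro v hv
        rw [← Real.sqrt_le_left (by positivity)]
        have := (Real.sqrt_le_left hR).2 hv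
        linarith [key v]
      simp only [searchTime, Finset.sum_add_distrib]
      refine Nat.add_le_add_right (Nat.add_le_add_left ?_ _) 1
      refine sum_window_le
        (F := fun v => if a + cellDist (u i) v ^ 2 ≤ R ^ 2 then
          searchTime Q (R ^ 2) u r (i + 1) (a + cellDist (u i) v ^ 2) else 0)
        (G := fun v => if b + cellDist (w i) v ^ 2 ≤ (2 * R) ^ 2 then
          searchTime Q ((2 * R) ^ 2) w r (i + 1) (b + cellDist (w i) v ^ 2) else 0) fun v hv => ?_
      have hv' : a + cellDist (u i) v ^ 2 ≤ R ^ 2 := by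
        by_contra h
        exact hv (if_neg h)
      rw [if_pos hv', if_pos (hok v hv')]
      refine ⟨ih _ _ _ (by omega) (by positivity) (by positivity) (key v), ?_⟩
      have hlt : cellDist (w i) v < Q := by
        refine lt_of_le_of_lt ?_ hQ
        refine (abs_le_of_sq_le_sq' ?_ (by positivity)).2
        linarith [hok v hv']
      have := mem_window hlt
      push_cast
      omega

/-- The sum of the Gaussian weights of the cells around the one containing `u`. -/
noncomputable def gaussWeight (Q : ℕ) (lam u : ℝ) : ℝ :=
  ∑ o ∈ Finset.range (2 * Q + 1), Real.exp (-lam * cellDist u (⌊u⌋ - Q + o) ^ 2)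

theorem one_le_gaussWeight (Q : ℕ) (lam u : ℝ) : 1 ≤ gaussWeight Q lam u := by
  have h : Real.exp (-lam * cellDist u (⌊u⌋ - Q + (Q : ℕ)) ^ 2) ≤ gaussWeight Q lam u :=
    Finset.single_le_sum (f := fun o : ℕ => Real.exp (-lam * cellDist u (⌊u⌋ - Q + o) ^ 2))
      (fun _ _ => (Real.exp_pos _).le) (Finset.mem_range.2 (by omega))
  rwa [sub_add_cancel, cellDist_floor, zero_pow two_ne_zero, mul_zero, Real.exp_zero] at h

/-- The Chernoff-type bound for the number of cells near a point: the condition that the squared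
distances add up to at most `B` is relaxed to a product of Gaussian weights. -/
theorem searchTime_le_gaussWeight {Q : ℕ} {B lam : ℝ} (hlam : 0 ≤ lam) {u : ℕ → ℝ} (r : ℕ) :
    ∀ (i : ℕ) (a : ℝ), a ≤ B →
      (searchTime Q B u r i a : ℝ) ≤ (r * (2 * Q + 2) + 1) * (Real.exp (lam * (B - a)) *
        ∏ k ∈ Finset.range r, gaussWeight Q lam (u (i + k))) := by
  induction r with
  | zero =>
      intro i a ha
      simpa [searchTime] using Real.one_le_exp (mul_nonneg hlam (sub_nonneg.2 ha))
  | succ r ih =>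
      intro i a ha
      rw [Finset.prod_range_succ']
      simp only [searchTime, Finset.sum_add_distrib, add_zero]
      rw [show ∏ k ∈ Finset.range r, gaussWeight Q lam (u (i + (k + 1))) =
        ∏ k ∈ Finset.range r, gaussWeight Q lam (u (i + 1 + k)) from
        Finset.prod_congr rfl fun k _ => by rw [add_right_comm, add_assoc]]
      set P := ∏ k ∈ Finset.range r, gaussWeight Q lam (u (i + 1 + k))
      have hP : 1 ≤ P := Finset.one_le_prod fun k _ => one_le_gaussWeight _ _ _
      have hE : 1 ≤ Real.exp (lam * (B - a)) :=
        Real.one_le_exp (mul_nonneg hlam (sub_nonneg.2 ha))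
      have hW := one_le_gaussWeight Q lam (u i)
      have hterm : ∀ v, ((if a + cellDist (u i) v ^ 2 ≤ B then
          searchTime Q B u r (i + 1) (a + cellDist (u i) v ^ 2) else 0 : ℕ) : ℝ) ≤
          (r * (2 * Q + 2) + 1) * (Real.exp (lam * (B - a)) * P) *
            Real.exp (-lam * cellDist (u i) v ^ 2) := by
        intro v
        split_ifs with hv
        · refine (ih (i + 1) _ hv).trans (le_of_eq ?_)
          rw [show lam * (B - (a + cellDist (u i) v ^ 2)) =
            lam * (B - a) + -lam * cellDist (u i) v ^ 2 by ring, Real.exp_add]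
          ring
        · rw [Nat.cast_zero]; positivity
      have hsum := Finset.sum_le_sum fun (o : ℕ) (_ : o ∈ Finset.range (2 * Q + 1)) =>
        hterm (⌊u i⌋ - Q + o)
      rw [← Finset.mul_sum] at hsum
      change _ ≤ _ * gaussWeight Q lam (u i) at hsum
      have hone : 1 ≤ Real.exp (lam * (B - a)) * P * gaussWeight Q lam (u i) :=
        one_le_mul_of_one_le_of_one_le (one_le_mul_of_one_le_of_one_le hE hP) hW
      push_cast at hsum ⊢
      simp only [Finset.sum_const, Finset.card_range, nsmul_eq_mul, mul_one]
      push_cast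
      nlinarith [mul_nonneg (show (0 : ℝ) ≤ 2 * Q + 2 by positivity) (sub_nonneg.2 hone)]

theorem measurable_cellDist (v : ℤ) : Measurable fun u : ℝ => cellDist u v := by
  unfold cellDist
  refine Measurable.ite measurableSet_Iic (by fun_prop) (Measurable.ite measurableSet_Ici
    (by fun_prop) measurable_const)

theorem measurable_cellDist_floor_add (o : ℤ) : Measurable fun u : ℝ => cellDist u (⌊u⌋ + o) := by
  unfold cellDist
  have h : Measurable fun u : ℝ => ((⌊u⌋ + o : ℤ) : ℝ) :=
    (measurable_from_top (f := fun n : ℤ => ((n + o : ℤ) : ℝ))).comp Int.measurable_floor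
  exact Measurable.ite (measurableSet_le measurable_id h) (h.sub measurable_id)
    (Measurable.ite (measurableSet_le (h.add_const 1) measurable_id)
      (measurable_id.sub (h.add_const 1)) measurable_const)

theorem measurable_searchTime {Ω : Type*} [MeasurableSpace Ω] {Q : ℕ} {B : ℝ} {u : ℕ → Ω → ℝ}
    (hu : ∀ k, Measurable (u k)) (r : ℕ) : ∀ (i : ℕ) (a : Ω → ℝ), Measurable a →
      Measurable fun ω => searchTime Q B (fun k => u k ω) r i (a ω) := by
  induction r with
  | zero => intros; simp only [searchTime]; exact measurable_const
  | succ r ih =>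
      intro i a ha
      simp only [searchTime]
      refine Measurable.add_const (Finset.measurable_sum _ fun o _ => ?_) 1
      have hD : Measurable fun ω => a ω + cellDist (u i ω) (⌊u i ω⌋ - Q + o) ^ 2 := by
        have : ∀ ω, ⌊u i ω⌋ - (Q : ℤ) + (o : ℤ) = ⌊u i ω⌋ + (-Q + o) := fun ω => by ring
        simp only [this]
        exact ha.add (((measurable_cellDist_floor_add _).comp (hu i)).pow_const 2)
      exact measurable_const.add (Measurable.ite (measurableSet_le hD measurable_const)
        (ih _ _ hD) measurable_const)

theorem measurable_gaussWeight (Q : ℕ) (lam : ℝ) : Measurable (gaussWeight Q lam) := by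
  unfold gaussWeight
  refine Finset.measurable_sum _ fun o _ => ?_
  have : ∀ u : ℝ, ⌊u⌋ - (Q : ℤ) + (o : ℤ) = ⌊u⌋ + (-Q + o) := fun ω => by ring
  simp only [this]
  exact (((measurable_cellDist_floor_add _).pow_const 2).const_mul _).exp

end CellSearch

/-! ### The probability that a random shift is bad -/

namespace CellSearch

theorem cellDist_sub (u : ℝ) (v : ℤ) : cellDist (u - v) 0 = cellDist u v := by
  unfold cellDist
  push_cast
  split_ifs <;> linarith

theorem lintegral_cellDist_le {lam : ℝ} (hlam : 0 < lam) :
    ∫⁻ w : ℝ, ENNReal.ofReal (Real.exp (-lam * cellDist w 0 ^ 2)) ≤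
      ENNReal.ofReal (1 + 2 * √(Real.pi / lam)) := by
  have hpt : ∀ w : ℝ, ENNReal.ofReal (Real.exp (-lam * cellDist w 0 ^ 2)) ≤
      (Set.Icc (0 : ℝ) 1).indicator 1 w + (ENNReal.ofReal (Real.exp (-lam * w ^ 2)) +
        ENNReal.ofReal (Real.exp (-lam * (w - 1) ^ 2))) := by
    intro w
    unfold cellDist
    push_cast
    split_ifs with h1 h2
    · refine le_add_left (le_add_right (le_of_eq ?_))
      rw [zero_sub, neg_sq]
    · refine le_add_left (le_add_left (le_of_eq ?_))
      rw [zero_add]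
    · refine le_add_right ?_
      rw [Set.indicator_of_mem (by constructor <;> linarith)]
      simp
  have hg : ∫⁻ w : ℝ, ENNReal.ofReal (Real.exp (-lam * w ^ 2)) =
      ENNReal.ofReal √(Real.pi / lam) := by
    rw [← integral_gaussian, ofReal_integral_eq_lintegral_ofReal (integrable_exp_neg_mul_sq hlam)
      (Filter.Eventually.of_forall fun _ => (Real.exp_pos _).le)]
  refine (lintegral_mono hpt).trans (le_of_eq ?_)
  rw [lintegral_add_left (measurable_one.indicator measurableSet_Icc),
    lintegral_add_left (by fun_prop), lintegral_indicator_one measurableSet_Icc,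
    lintegral_sub_right_eq_self (fun w => ENNReal.ofReal (Real.exp (-lam * w ^ 2))) 1, hg,
    Real.volume_Icc, ← ENNReal.ofReal_add (by positivity) (by positivity),
    ← ENNReal.ofReal_add (by norm_num) (by positivity)]
  congr 1
  ring

/-- The expected Gaussian weight of the cells around a uniformly shifted point. Summing over all
cells unfolds the integral over the unit interval to one over the whole line. -/
theorem lintegral_gaussWeight_le {lam : ℝ} (hlam : 0 < lam) (Q : ℕ) (a : ℝ) :
    ∫⁻ s : unitInterval, ENNReal.ofReal (gaussWeight Q lam (a + s)) ≤
      ENNReal.ofReal (1 + 2 * √(Real.pi / lam)) := by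
  set g : ℝ → ENNReal := fun w => ENNReal.ofReal (Real.exp (-lam * cellDist w 0 ^ 2)) with hgdef
  have hgm : Measurable g := by
    have := measurable_cellDist 0
    fun_prop
  have hle : ∀ u, ENNReal.ofReal (gaussWeight Q lam u) ≤ ∑' k : ℤ, g (u - k) := by
    intro u
    unfold gaussWeight
    rw [ENNReal.ofReal_sum_of_nonneg fun _ _ => (Real.exp_pos _).le]
    have hinj : Function.Injective fun o : ℕ => ⌊u⌋ - (Q : ℤ) + (o : ℤ) := fun o o' h => by
      simpa using h
    have := ENNReal.sum_le_tsum (f := fun k : ℤ => g (u - k))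
      ((Finset.range (2 * Q + 1)).map ⟨_, hinj⟩)
    rw [Finset.sum_map] at this
    refine le_trans (le_of_eq ?_) this
    refine Finset.sum_congr rfl fun o _ => ?_
    simp only [hgdef, Function.Embedding.coeFn_mk, cellDist_sub]
  calc ∫⁻ s : unitInterval, ENNReal.ofReal (gaussWeight Q lam (a + s))
      ≤ ∫⁻ s : unitInterval, ∑' k : ℤ, g (a + s - k) := lintegral_mono fun s => hle _
    _ = ∫⁻ s in Set.Ioc (0 : ℝ) 1, ∑' k : ℤ, g (a + s - k) := by
        rw [← restrict_Ioc_eq_restrict_Icc.symm]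
        exact lintegral_subtype_comap measurableSet_Icc fun s : ℝ => ∑' k : ℤ, g (a + s - k)
    _ = ∑' k : ℤ, ∫⁻ s in Set.Ioc (0 : ℝ) 1, g (a + s - k) :=
        lintegral_tsum fun k => by fun_prop
    _ = ∑' k : ℤ, ∫⁻ w in Set.Ioc (a + (k : ℤ)) (a + (k : ℤ) + 1), g w := by
        rw [← (Equiv.neg ℤ).tsum_eq]
        refine tsum_congr fun k => ?_
        have h := (measurePreserving_add_left (volume : Measure ℝ) (a + k)).setLIntegral_comp_preimage
          (measurableSet_Ioc (a := a + k) (b := a + k + 1)) hgm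
        rw [← h]
        have hpre : (fun x => a + (k : ℝ) + x) ⁻¹' Set.Ioc (a + (k : ℝ)) (a + k + 1) =
            Set.Ioc 0 1 := by
          ext x; simp
        rw [hpre]
        refine lintegral_congr fun x => ?_
        congr 1
        simp only [Equiv.neg_apply]
        push_cast
        ring
    _ = ∫⁻ w : ℝ, g w := by
        rw [← lintegral_iUnion (fun _ => measurableSet_Ioc) (Set.pairwise_disjoint_Ioc_add_intCast a),
          iUnion_Ioc_add_intCast, Measure.restrict_univ]
    _ ≤ _ := lintegral_cellDist_le hlam

theorem prod_range_mul {M : Type*} [CommMonoid M] (f : ℕ → M) (m d : ℕ) :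
    ∏ n ∈ Finset.range (m * d), f n =
      ∏ j ∈ Finset.range m, ∏ k ∈ Finset.range d, f (j * d + k) := by
  induction m with
  | zero => simp
  | succ m ih => rw [Nat.succ_mul, Finset.prod_range_add, ih, Finset.prod_range_succ]

/-- For a fixed point, the probability that all `m` shifts are bad. Markov's inequality is applied
to the product over all shifts of the relaxed search times, which is a product of functions of the
single entries of the tape. -/
theorem tapeMeasure_forall_lt_searchTime_le {Q d m Λ : ℕ} {B lam : ℝ} (hlam : 0 < lam) (hB : 0 ≤ B)
    (hΛ : 0 < Λ)
    (h : 2 * (m * ((d * (2 * Q + 2) + 1) * (Real.exp (lam * B) *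
      (1 + 2 * √(Real.pi / lam)) ^ d))) ≤ (Λ : ℝ)) (a : ℕ → ℝ) :
    RealRAM.tapeMeasure {ω : RealRAM.Tape | ∀ j < m,
      Λ < searchTime Q B (fun k => a k + ω (j * d + k)) d 0 0 * m} ≤ ENNReal.ofReal (1 / 2) ^ m := by
  set K : ℝ := m * ((d * (2 * Q + 2) + 1) * Real.exp (lam * B)) / Λ with hK
  have hK0 : 0 ≤ K := by positivity
  have hΛ' : (0 : ℝ) < Λ := by exact_mod_cast hΛ
  set c : ℝ := 1 + 2 * √(Real.pi / lam) with hc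
  have hc0 : 0 ≤ c := by positivity
  have hKc : K * c ^ d ≤ 1 / 2 := by
    rw [hK, div_mul_eq_mul_div, div_le_div_iff₀ hΛ' two_pos]
    linarith
  let W : ℕ → RealRAM.Tape → ENNReal := fun n ω =>
    ENNReal.ofReal (gaussWeight Q lam (a (n % d) + ω n))
  have hWm : ∀ n, Measurable fun s : unitInterval =>
      ENNReal.ofReal (gaussWeight Q lam (a (n % d) + s)) := fun n =>
    ((measurable_gaussWeight Q lam).comp (by fun_prop)).ennreal_ofReal
  have hind : ProbabilityTheory.iIndepFun W RealRAM.tapeMeasure :=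
    ProbabilityTheory.iIndepFun_infinitePi hWm
  have hWmeas : ∀ n, Measurable (W n) := fun n => (hWm n).comp (measurable_pi_apply n)
  have hint : ∀ n, ∫⁻ ω, W n ω ∂(RealRAM.tapeMeasure) ≤ ENNReal.ofReal c := by
    intro n
    refine le_trans (le_of_eq ?_) (lintegral_gaussWeight_le hlam Q (a (n % d)))
    exact (measurePreserving_eval_infinitePi (fun _ : ℕ => (volume : Measure unitInterval))
      n).lintegral_comp (hWm n)
  have hsub : {ω : RealRAM.Tape | ∀ j < m,
      Λ < searchTime Q B (fun k => a k + ω (j * d + k)) d 0 0 * m} ⊆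
      {ω | 1 ≤ ENNReal.ofReal K ^ m * ∏ n ∈ Finset.range (m * d), W n ω} := by
    intro ω hω
    have hj : ∀ j ∈ Finset.range m, 1 ≤ ENNReal.ofReal K * ∏ k ∈ Finset.range d, W (j * d + k) ω := by
      intro j hj
      have h1 := hω j (Finset.mem_range.1 hj)
      have h2 := searchTime_le_gaussWeight (Q := Q) hlam.le
        (u := fun k => a k + ω (j * d + k)) d 0 0 hB
      have h3 : ∏ k ∈ Finset.range d, W (j * d + k) ω = ENNReal.ofReal
          (∏ k ∈ Finset.range d, gaussWeight Q lam (a k + ω (j * d + k))) := by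
        rw [ENNReal.ofReal_prod_of_nonneg fun k _ => zero_le_one.trans (one_le_gaussWeight _ _ _)]
        refine Finset.prod_congr rfl fun k hk => ?_
        simp only [W]
        rw [Nat.mul_add_mod', Nat.mod_eq_of_lt (Finset.mem_range.1 hk)]
      rw [h3, ← ENNReal.ofReal_mul hK0, ENNReal.one_le_ofReal, hK, div_mul_eq_mul_div,
        one_le_div hΛ']
      have h4 : (Λ : ℝ) ≤
          searchTime Q B (fun k => a k + ω (j * d + k)) d 0 0 * m := by exact_mod_cast h1.le
      refine h4.trans ?_
      simp only [sub_zero, zero_add] at h2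
      nlinarith [mul_le_mul_of_nonneg_right h2 (Nat.cast_nonneg (α := ℝ) m)]
    have := Finset.one_le_prod' hj
    rw [Finset.prod_mul_distrib, Finset.prod_const, Finset.card_range, ← prod_range_mul fun n => W n ω] at this
    exact this
  have hmark := mul_meas_ge_le_lintegral₀ (μ := RealRAM.tapeMeasure)
    (f := fun ω => ENNReal.ofReal K ^ m * ∏ n ∈ Finset.range (m * d), W n ω)
    (by fun_prop) 1
  rw [one_mul] at hmark
  refine (measure_mono hsub).trans (hmark.trans ?_)
  rw [lintegral_const_mul _ (by fun_prop),
    ProbabilityTheory.lintegral_prod_eq_prod_lintegral_of_indepFun _ _ hind hWmeas]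
  calc ENNReal.ofReal K ^ m * ∏ n ∈ Finset.range (m * d), ∫⁻ ω, W n ω ∂(RealRAM.tapeMeasure)
      ≤ ENNReal.ofReal K ^ m * ∏ n ∈ Finset.range (m * d), ENNReal.ofReal c := by
        gcongr with n _
        exact hint n
    _ = ENNReal.ofReal (K * c ^ d) ^ m := by
        rw [Finset.prod_const, Finset.card_range, mul_comm m d, pow_mul, ← mul_pow,
          ENNReal.ofReal_mul hK0, ENNReal.ofReal_pow hc0]
    _ ≤ _ := by gcongr

end CellSearch

/-! ### The programs -/

namespace RealRAM

/-- The integer variable stored at index `0` of array `a`. -/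
abbrev ivar (a : ℕ) : IExp := .get a (.lit 0)

/-- The real variable stored at index `0` of array `a`. -/
abbrev rvar (a : ℕ) : RExp := .get a (.lit 0)

/-- The test `e < f` for integers. -/
abbrev ilt (e f : IExp) : BExp := .not (.ile f e)

/-- `a := e` for an integer variable. -/
abbrev assign (a : ℕ) (e : IExp) : Cmd := .setI a (.lit 0) e

/-- `a := a + 1` for an integer variable. -/
abbrev incr (a : ℕ) : Cmd := assign a (.add (ivar a) (.lit 1))

/-- Appends the cells chosen by the search and the number of the shift to the output list. -/
def listLeaf : Cmd :=
  .seq (assign 20 (.lit 0)) <|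
  .seq (.loop (ilt (ivar 20) (ivar 0))
    (.seq (.setI 4 (ivar 18) (.sub (.get 16 (.add (ivar 20) (.lit 1))) (.lit 1)))
      (.seq (incr 18) (incr 20)))) <|
  .seq (.setI 4 (ivar 18) (ivar 11)) <|
  .seq (incr 18) <|
  .seq (incr 3) <|
  assign 15 (ivar 0)

/-- Computes the distance from the current coordinate to the next candidate. -/
def candidateDist : Cmd :=
  let v : RExp := .ofInt (.get 16 (ivar 15))
  let v' : RExp := .ofInt (.add (.get 16 (ivar 15)) (.lit 1))
  let u : RExp := .get 5 (.sub (ivar 15) (.lit 1))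
  .ite (.rle u v) (.setR 7 (.lit 0) (.sub v u))
    (.ite (.rle v' u) (.setR 7 (.lit 0) (.sub u v')) (.setR 7 (.lit 0) (.ofInt (.lit 0))))

/-- Tests the next candidate of the current coordinate, and moves on to the next coordinate if the
squared distance is small enough. -/
def tryCandidate : Cmd :=
  .seq candidateDist <|
  .seq (.setI 16 (ivar 15) (.add (.get 16 (ivar 15)) (.lit 1))) <|
  .seq (.setR 7 (.lit 0) (.add (.get 6 (ivar 15)) (.mul (rvar 7) (rvar 7)))) <|
  .ite (.rle (rvar 7) (rvar 4))
    (.seq (incr 15) (.seq (.setR 6 (ivar 15) (rvar 7))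
      (.setI 16 (ivar 15) (.sub (.get 14 (.sub (ivar 15) (.lit 1))) (ivar 5)))))
    .skip

/-- One round of the backtracking search. -/
def searchRound : Cmd :=
  .seq (incr 17) <|
  .ite (ilt (ivar 0) (ivar 15)) listLeaf <|
  .ite (.ile (.get 16 (ivar 15)) (.add (.get 14 (.sub (ivar 15) (.lit 1))) (ivar 5)))
    tryCandidate (assign 15 (.sub (ivar 15) (.lit 1)))

/-- The backtracking search, which is abandoned when the number of rounds times the number of
shifts would exceed `Λ`. -/
def searchLoop : Cmd :=
  .loop (.and (.ile (.lit 1) (ivar 15))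
    (.rle (.mul (.ofInt (.add (ivar 17) (.lit 1))) (.ofInt (ivar 6))) (.ofInt (.get 0 (.lit 2)))))
    searchRound

/-- Computes the coordinates of the query point in the shifted and scaled grid, and their integer
parts. -/
def locate : Cmd :=
  .seq (assign 13 (.lit 0)) <|
  .loop (ilt (ivar 13) (ivar 0)) <|
  .seq (.setR 5 (ivar 13) (.add (.mul (.ofInt (.get 1 (ivar 13))) (rvar 2))
    (.get 1 (.add (ivar 12) (ivar 13))))) <|
  .seq (.floor 14 (ivar 13) (.get 5 (ivar 13))) <|
  incr 13

/-- Initialization of the search. -/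
def searchInit : Cmd :=
  .seq (assign 15 (.lit 1)) <|
  .seq (.setI 16 (.lit 1) (.sub (ivar 14) (ivar 5))) <|
  .seq (.setR 6 (.lit 1) (.ofInt (.lit 0))) <|
  assign 17 (.lit 0)

/-- If the search was completed, and this is the first shift for which it was, then the cell of the
query point and the number of the shift become the value of the hash function. -/
def recordValue : Cmd :=
  .ite (.and (.ile (ivar 15) (.lit 0)) (.ile (ivar 19) (.lit 0)))
    (.seq (assign 20 (.lit 0)) <|
      .seq (.loop (ilt (ivar 20) (ivar 0))
        (.seq (.setI 2 (ivar 20) (.get 14 (ivar 20))) (incr 20))) <|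
      .seq (.setI 2 (ivar 0) (ivar 11)) <|
      assign 19 (.lit 1))
    .skip

/-- The treatment of a single shift. -/
def scanRound : Cmd :=
  .seq locate <| .seq searchInit <| .seq searchLoop <| .seq recordValue <|
  .seq (incr 11) <| assign 12 (.add (ivar 12) (ivar 0))

/-- Initialization of a query. -/
def scanInit (f : ℤ) : Cmd :=
  .seq (.setR 4 (.lit 0)
    (.mul (.mul (.ofInt (.lit f)) (rvar 3)) (.mul (.ofInt (.lit f)) (rvar 3)))) <|
  .seq (assign 11 (.lit 0)) <| .seq (assign 12 (.lit 0)) <| .seq (assign 3 (.lit 0)) <|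
  .seq (assign 18 (.lit 0)) <| assign 19 (.lit 0)

/-- The query program. Both queries run the search in all shifts, a value query at radius `f = 2`
and a range query at radius `f = 1`, in terms of the radius `R = q / Γ` in real array `3`.

Integer arrays: `5` the width `q` of the search, `6` the number of shifts, `11` the current shift,
`12` the position of its entries in the table of shifts, `13` and `20` counters, `14` the integer
parts of the coordinates, `15` to `17` depth, candidates and rounds of the search, `18` the end of
the output list, `19` whether the value is known. Real arrays: `1` the table of shifts, `2` the
reciprocal of the cell width, `4` the bound for the squared distance, `5` the coordinates, `6` the
accumulated squared distances, `7` an auxiliary variable. -/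
def scan (f : ℤ) : Cmd :=
  .seq (scanInit f) (.loop (ilt (ivar 11) (ivar 6)) scanRound)

/-! ### Correctness of the queries -/

open CellSearch

variable {d Λ Q m : ℕ} {B : ℝ} {u : ℕ → ℝ} {j : ℤ}

/-- The quantities that are fixed during the search. -/
structure SearchEnv (d Λ Q m : ℕ) (B : ℝ) (u : ℕ → ℝ) (j : ℤ) (s : State) : Prop where
  dim : s.ints 0 0 = d
  cap : s.ints 0 2 = Λ
  width : s.ints 5 0 = Q
  shifts : s.ints 6 0 = m
  shift : s.ints 11 0 = j
  cell : ∀ i < d, s.ints 14 (i : ℤ) = ⌊u i⌋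
  coord : ∀ i < d, s.reals 5 (i : ℤ) = u i
  radius : s.reals 4 0 = B

theorem SearchEnv.congr {s s' : State} (h : SearchEnv d Λ Q m B u j s)
    (hi : ∀ a ∈ [0, 5, 6, 11, 14], s'.ints a = s.ints a)
    (hr : ∀ a ∈ [4, 5], s'.reals a = s.reals a) : SearchEnv d Λ Q m B u j s' := by
  have h0 := hi 0 (by decide)
  have h5 := hi 5 (by decide)
  have h6 := hi 6 (by decide)
  have h11 := hi 11 (by decide)
  have h14 := hi 14 (by decide)
  have r4 := hr 4 (by decide)
  have r5 := hr 5 (by decide)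
  obtain ⟨a1, a2, a3, a4, a5, a6, a7, a8⟩ := h
  constructor <;> simp_all

/-- The output area of the state `s` holds the list `L`. -/
structure OutRep (L : List (Fin (d + 1) → ℤ)) (s : State) : Prop where
  count : s.ints 3 0 = L.length
  ptr : s.ints 18 0 = (L.length * (d + 1) : ℕ)
  val : ∀ n (h : n < L.length), ∀ t : Fin (d + 1), s.ints 4 ((n * (d + 1) + t : ℕ) : ℤ) = L[n] t

theorem OutRep.congr {L : List (Fin (d + 1) → ℤ)} {s s' : State} (h : OutRep L s)
    (hi : ∀ a ∈ [3, 4, 18], s'.ints a = s.ints a) : OutRep L s' := by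
  obtain ⟨a1, a2, a3⟩ := h
  have h3 := hi 3 (by decide)
  have h4 := hi 4 (by decide)
  have h18 := hi 18 (by decide)
  constructor <;> simp_all

theorem OutRep.outSet_eq {L : List (Fin (d + 1) → ℤ)} {s : State} (h : OutRep L s) :
    s.outSet d = L.toFinset := by
  ext z
  simp only [State.outSet, h.count, Int.toNat_natCast, Finset.mem_image, Finset.mem_range,
    List.mem_toFinset]
  constructor
  · rintro ⟨n, hn, rfl⟩
    have : (fun t : Fin (d + 1) => s.ints 4 ((n * (d + 1) + t : ℕ) : ℤ)) = L[n] :=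
      funext fun t => h.val n hn t
    rw [this]
    exact List.getElem_mem hn
  · intro hz
    obtain ⟨n, hn, rfl⟩ := List.getElem_of_mem hz
    exact ⟨n, hn, funext fun t => h.val n hn t⟩

/-- The state `s` represents the state `σ` of the search after `t` rounds. -/
structure SearchRep (σ : SearchState d) (t : ℕ) (s : State) : Prop where
  depth : s.ints 15 0 = σ.depth
  rounds : s.ints 17 0 = t
  next : ∀ k ≤ d, s.ints 16 (k : ℤ) = σ.next k
  acc : ∀ k ≤ d + 1, s.reals 6 (k : ℤ) = σ.acc k
  out : OutRep σ.out s

theorem listLeaf_runs {s : State} {L : List (Fin (d + 1) → ℤ)} {next : ℕ → ℤ}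
    (hd : s.ints 0 0 = d) (hj : s.ints 11 0 = j) (hnext : ∀ k ≤ d, s.ints 16 (k : ℤ) = next k)
    (hL : OutRep L s) :
    Runs listLeaf s (40 * (d + 1)) fun s' =>
      s'.ints 15 0 = d ∧ OutRep (L ++ [encode d (fun i => next (i + 1) - 1) j]) s' := by
  obtain ⟨l1, l2, l3⟩ := hL
  set b : ℕ := L.length * (d + 1) with hb
  unfold listLeaf
  refine Runs.mono (Runs.seq (Runs.of_straight rfl (Runs.seq (Runs.mono
    (Runs.loop (N := d) (C := 26) (I := fun c s' =>
      (∀ a, a ≠ 4 → a ≠ 18 → a ≠ 20 → s'.ints a = s.ints a) ∧ s'.ints 20 0 = c ∧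
      s'.ints 18 0 = (b + c : ℕ) ∧ (∀ k < b, s'.ints 4 (k : ℤ) = s.ints 4 (k : ℤ)) ∧
      ∀ k < c, s'.ints 4 ((b + k : ℕ) : ℤ) = next (k + 1) - 1) ?_ ?_ ?_) le_rfl
      fun s' _ _ hs' => Runs.of_straight rfl ?_)))) ?_ fun _ _ _ h => h
  · rintro c s' hc ⟨h1, h2, h3, h4, h5⟩
    have h0 : s'.ints 0 0 = d := by rw [h1 0 (by decide) (by decide) (by decide), hd]
    have h16 : s'.ints 16 (c + 1) = next (c + 1) := by
      rw [h1 16 (by decide) (by decide) (by decide)]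
      exact_mod_cast hnext (c + 1) (by omega)
    refine ⟨by simp [BExp.eval, IExp.eval, h0, h2, hc], Runs.mono (Runs.of_straight (by decide)
      (Q := fun s'' => _) ?_) (by decide) fun _ _ _ h => h⟩
    simp only [Cmd.run, IExp.eval, State.setI_ints, h2, h3, h16, true_and]
    refine ⟨?_, ?_, ?_, ?_, ?_⟩
    · intro a a4 a18 a20
      funext k
      simp [State.setI_ints, a4, a18, a20, h1 a a4 a18 a20]
    · simp
    · simp; ring
    · intro k hk
      rw [if_neg (by omega), if_neg (by omega), if_neg (by omega), h4 k hk]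
    · intro k hk
      rw [if_neg (by omega), if_neg (by omega)]
      split_ifs with hkc
      · obtain rfl : k = c := by omega
        rfl
      · exact h5 k (by omega)
  · rintro s' ⟨h1, h2, -⟩
    have h0 : s'.ints 0 0 = d := by rw [h1 0 (by decide) (by decide) (by decide), hd]
    simp [BExp.eval, IExp.eval, h0, h2]
  · simp only [Cmd.run, IExp.eval]
    refine ⟨fun a _ _ a20 => ?_, ?_, ?_, ?_, by simp⟩
    · funext k; simp [State.setI_ints, a20]
    · simp [State.setI_ints]
    · simp [State.setI_ints, l2]
    · intro k hk; simp [State.setI_ints]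
  · obtain ⟨h1, h2, h3, h4, h5⟩ := hs'
    have h0 : s'.ints 0 0 = d := by rw [h1 0 (by decide) (by decide) (by decide), hd]
    have h11 : s'.ints 11 0 = j := by rw [h1 11 (by decide) (by decide) (by decide), hj]
    have h33 : s'.ints 3 0 = L.length := by rw [h1 3 (by decide) (by decide) (by decide), l1]
    simp only [Cmd.run, IExp.eval]
    refine ⟨by simp [State.setI_ints, h0], ?_, ?_, ?_⟩
    · simp [State.setI_ints, h33]
    · simp [State.setI_ints, h3, hb]; ring
    · intro n hn t
      have ht := t.2
      simp only [State.setI_ints, h3, h11, true_and]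
      rw [if_neg (by omega), if_neg (by omega), if_neg (by omega)]
      simp only [List.length_append, List.length_singleton] at hn
      rcases Nat.lt_or_ge n L.length with hnL | hnL
      · have hlt : n * (d + 1) + t < b := by
          have := Nat.mul_le_mul_right (d + 1) (Nat.succ_le_of_lt hnL)
          rw [Nat.succ_mul] at this
          omega
        rw [if_neg (by omega), h4 _ hlt, l3 n hnL t, List.getElem_append_left hnL]
      · obtain rfl : n = L.length := by omega
        rw [← hb, List.getElem_append_right le_rfl, List.getElem_singleton, encode]
        split_ifs with h6 h7 h7
        · omega
        · rfl
        · exact h5 t h7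
        · omega
  · simp only [Cmd.bound, IExp.cost, BExp.cost]
    omega

theorem candidateDist_run {s : State} {x : ℝ} {v p : ℤ} (hp : s.ints 15 0 = p)
    (hv : s.ints 16 p = v) (hx : s.reals 5 (p - 1) = x) :
    candidateDist.run s = s.setR 7 0 (cellDist x v) := by
  simp only [candidateDist, Cmd.run, BExp.eval, RExp.eval, IExp.eval, hp, hv, hx, cellDist]
  push_cast
  split_ifs <;> rfl

theorem tryCandidate_runs {s : State} {σ : SearchState d} {t : ℕ}
    (hE : SearchEnv d Λ Q m B u j s) (hσ : SearchRep σ t s) (hpos : 0 < σ.depth)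
    (hle : σ.depth ≤ d) (hwin : σ.next σ.depth ≤ ⌊u (σ.depth - 1)⌋ + Q) :
    Runs tryCandidate s 150 fun s' => SearchRep (step Q B u j σ) t s' := by
  obtain ⟨p, hp⟩ : ∃ p, σ.depth = p + 1 := ⟨σ.depth - 1, by omega⟩
  refine Runs.mono (Runs.of_straight rfl (Q := fun s' => _) ?_) (by decide) fun _ _ _ h => h
  obtain ⟨e1, e2, e3, e4, e5, e6, e7, e8⟩ := hE
  obtain ⟨r1, r2, r3, r4, r5, r6, r7⟩ := hσ
  rw [hp, Nat.add_sub_cancel] at hwin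
  have g1 : s.ints 15 0 = (p : ℤ) + 1 := by rw [r1, hp]; push_cast; rfl
  have g2 : s.ints 16 ((p : ℤ) + 1) = σ.next (p + 1) := by exact_mod_cast r3 (p + 1) (by omega)
  have g3 : s.reals 6 ((p : ℤ) + 1) = σ.acc (p + 1) := by exact_mod_cast r4 (p + 1) (by omega)
  have g4 : s.reals 5 ((p : ℤ) + 1 - 1) = u p := by
    rw [add_sub_cancel_right]; exact e7 p (by omega)
  have hrun := candidateDist_run g1 g2 g4
  set D := cellDist (u p) (σ.next (p + 1))
  unfold tryCandidate step
  dsimp only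
  rw [if_neg (by omega), hp, Nat.add_sub_cancel, if_pos hwin]
  simp only [Cmd.run, hrun, BExp.eval, RExp.eval, IExp.eval, State.setI_ints, State.setR_reals,
    State.setI_reals, State.setR_ints, g1, g2, e8]
  simp only [and_true, Nat.reduceEqDiff, false_and, if_false, if_true]
  rw [g3, ← pow_two, add_sub_cancel_right, e3]
  by_cases hc : σ.acc (p + 1) + D ^ 2 ≤ B
  · rw [if_pos hc, if_pos hc]
    refine ⟨?_, ?_, ?_, ?_, ?_, ?_, ?_⟩
    · simp [State.setI_ints]
    · simp [State.setI_ints, r2]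
    · intro k hk
      simp only [State.setI_ints, State.setR_ints, Function.update_apply, true_and]
      by_cases h1 : k = p + 1 + 1
      · subst h1
        rw [if_pos (by push_cast; ring), if_pos rfl]
        have := e6 (p + 1) (by omega)
        push_cast at this
        rw [this]
      · rw [if_neg (by omega), if_neg (by omega), if_neg h1]
        by_cases h2 : k = p + 1
        · subst h2
          rw [if_pos (by push_cast; ring), if_pos rfl]
        · rw [if_neg (by omega), if_neg h2, r3 k hk]
    · intro k hk
      simp only [State.setR_reals, State.setI_reals, Function.update_apply, true_and]
      by_cases h1 : k = p + 1 + 1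
      · subst h1
        rw [if_pos (by push_cast; ring), if_pos rfl]
      · rw [if_neg (by omega), if_neg (by omega), if_neg h1, if_neg (by omega), r4 k hk]
    · simpa [State.setI_ints] using r5
    · simpa [State.setI_ints] using r6
    · intro n hn t
      simpa [State.setI_ints] using r7 n hn t
  · rw [if_neg hc, if_neg hc]
    refine ⟨?_, ?_, ?_, ?_, ?_, ?_, ?_⟩
    · simp [State.setI_ints, g1]
    · simp [State.setI_ints, r2]
    · intro k hk
      simp only [State.setI_ints, State.setR_ints, Function.update_apply, true_and]
      by_cases h2 : k = p + 1
      · subst h2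
        rw [if_pos (by push_cast; ring), if_pos rfl]
      · rw [if_neg (by omega), if_neg h2, r3 k hk]
    · intro k hk
      simp only [State.setR_reals, State.setI_reals]
      rw [if_neg (by omega), if_neg (by omega), r4 k hk]
    · simpa [State.setI_ints] using r5
    · simpa [State.setI_ints] using r6
    · intro n hn t
      simpa [State.setI_ints] using r7 n hn t

theorem searchRound_runs {s : State} {σ : SearchState d} {t : ℕ}
    (hE : SearchEnv d Λ Q m B u j s) (hσ : SearchRep σ t s) (hpos : 0 < σ.depth)
    (hle : σ.depth ≤ d + 1) :
    Runs searchRound s (220 * (d + 1)) fun s' =>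
      SearchEnv d Λ Q m B u j s' ∧ SearchRep (step Q B u j σ) (t + 1) s' := by
  refine Runs.mono (Q := fun s' => SearchRep (step Q B u j σ) (t + 1) s')
    (Runs.seq (T₂ := 199 * (d + 1)) (Runs.of_straight rfl ?_))
    (by simp only [Cmd.bound, IExp.cost]; omega) fun s' _ he hs' =>
      ⟨hE.congr (fun a ha => he.ints_eq ?_) (fun a ha => he.reals_eq ?_), hs'⟩
  · set s₁ := (incr 17).run s with hs₁
    have hi : ∀ a ≠ 17, s₁.ints a = s.ints a := by
      intro a ha
      funext k
      simp [hs₁, Cmd.run, State.setI_ints, ha]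
    have hE₁ : SearchEnv d Λ Q m B u j s₁ :=
      hE.congr (fun a ha => hi a (by rintro rfl; simp at ha)) fun a _ => rfl
    have hσ₁ : SearchRep σ (t + 1) s₁ := by
      obtain ⟨r1, r2, r3, r4, r5⟩ := hσ
      refine ⟨by rw [hi _ (by decide), r1], ?_, by rw [hi _ (by decide)]; exact r3, r4,
        r5.congr fun a ha => hi a (by rintro rfl; simp at ha)⟩
      simp [hs₁, Cmd.run, State.setI_ints, IExp.eval, r2]
    have e1 := hE₁.dim
    have g1 := hσ₁.depth
    have hdep : ¬ (ilt (ivar 0) (ivar 15)).eval s₁ → σ.depth ≤ d := fun hb => by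
      simpa [BExp.eval, IExp.eval, e1, g1] using hb
    have hw : σ.depth ≤ d → ((BExp.ile (.get 16 (ivar 15))
        (.add (.get 14 (.sub (ivar 15) (.lit 1))) (ivar 5))).eval s₁ ↔
          σ.next σ.depth ≤ ⌊u (σ.depth - 1)⌋ + Q) := by
      intro hd
      have g2 := hσ₁.next σ.depth hd
      have g3 : s₁.ints 14 ((σ.depth : ℤ) - 1) = ⌊u (σ.depth - 1)⌋ := by
        rw [← hE₁.cell _ (by omega)]
        congr 1
        omega
      simp [BExp.eval, IExp.eval, g1, g2, g3, hE₁.width]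
    refine Runs.mono (Runs.ite (T := 180 * (d + 1)) (fun hb => ?_) fun hb => Runs.mono
      (Runs.ite (T := 160) (fun hb' => ?_) fun hb' => ?_) ?_ fun _ _ _ h => h) ?_ fun _ _ _ h => h
    · have hd : d < σ.depth := by simpa [BExp.eval, IExp.eval, e1, g1] using hb
      refine Runs.mono (listLeaf_runs e1 hE₁.shift hσ₁.next hσ₁.out) (by omega) ?_
      rintro s' _ he ⟨h1, h2⟩
      unfold step
      rw [if_pos hd]
      refine ⟨h1, by rw [he.ints_eq (by decide), hσ₁.rounds], ?_, ?_, h2⟩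
      · rw [he.ints_eq (by decide)]; exact hσ₁.next
      · rw [he.reals_eq (by decide)]; exact hσ₁.acc
    · exact Runs.mono (tryCandidate_runs hE₁ hσ₁ hpos (hdep hb) ((hw (hdep hb)).1 hb')) (by decide) fun _ _ _ h => h
    · refine Runs.mono (Runs.of_straight rfl (Q := fun s' => _) ?_) (by decide) fun _ _ _ h => h
      unfold step
      rw [if_neg (by have := hdep hb; omega), if_neg fun h => hb' ((hw (hdep hb)).2 h)]
      obtain ⟨r1, r2, r3, r4, r5⟩ := hσ₁
      simp only [Cmd.run, IExp.eval, g1]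
      refine ⟨?_, ?_, ?_, r4, ?_⟩
      · simp [State.setI_ints]; omega
      · simpa [State.setI_ints] using r2
      · simpa [State.setI_ints] using r3
      · refine r5.congr fun a ha => ?_
        funext k
        have : a ≠ 15 := by rintro rfl; simp at ha
        simp [State.setI_ints, this]
    · simp [BExp.cost, IExp.cost]; omega
    · simp [BExp.cost, IExp.cost]; omega
  · fin_cases ha <;> decide
  · fin_cases ha <;> decide

/-- A shift is good for a point, given by its coordinates `u` in the shifted grid, if the search is
not abandoned. -/
def Good (d Λ Q m : ℕ) (B : ℝ) (u : ℕ → ℝ) : Prop := searchTime Q B u d 0 0 * m ≤ Λ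

/-- The search loop runs for `searchTime` rounds, or until the budget of `Λ / m` rounds is used up.
In both cases what it lists is sound, and in the first case it is complete. -/
theorem searchLoop_runs {s : State} {L : List (Fin (d + 1) → ℤ)}
    (hE : SearchEnv d Λ Q m B u j s) (hB0 : 0 ≤ B) (hB : B < (Q : ℝ) ^ 2) (hm : 0 < m)
    (hdepth : s.ints 15 0 = 1) (hrounds : s.ints 17 0 = 0) (hnext : s.ints 16 1 = ⌊u 0⌋ - Q)
    (hacc : s.reals 6 1 = 0) (hL : OutRep L s) :
    Runs searchLoop s (Λ / m * (250 * (d + 1)) + 20) fun s' =>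
      ∃ L', OutRep (L ++ L') s' ∧ OutSound B u j L' ∧ L'.length ≤ Λ / m ∧
        (Good d Λ Q m B u → ∀ v, ∑ i ∈ Finset.range d, cellDist (u i) (v i) ^ 2 ≤ B →
          encode d v j ∈ L ++ L') ∧ (s'.ints 15 0 ≤ 0 ↔ Good d Λ Q m B u) := by
  -- Old memory contents are taken over into the initial state; they are overwritten before use.
  set σ : SearchState d := ⟨1, fun k => s.ints 16 k, fun k => s.reals 6 k, L⟩ with hσ
  have hσacc : σ.acc (0 + 1) = 0 := by simpa [hσ] using hacc
  have hex := exists_explores (j := j) hB d 0 σ (by omega) (by simp [hσ])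
    (by rw [hσacc]) (fun _ => by simpa [hσ] using hnext)
  rw [hσacc] at hex
  set τ := searchTime Q B u d 0 0 with hτ
  have hgood : Good d Λ Q m B u ↔ τ ≤ Λ / m := by
    rw [Good, ← hτ, Nat.le_div_iff_mul_le hm]
  have hsound : ∀ k ≤ τ, Sound B u j L ((step Q B u j)^[k] σ) := by
    intro k hk
    refine Sound.iterate ⟨by simp [hσ], ?_, ?_, [], by simp [hσ], by simp [OutSound]⟩
      fun i hi => hex.lt_depth i (by omega)
    · intro i hi
      obtain rfl : i = 0 := by simpa [hσ] using hi
      rw [hσacc]; simp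
    · intro i hi
      obtain rfl : i = 0 := by simpa [hσ] using hi
      rw [hσacc]; exact hB0
  have hguard : ∀ k s', SearchEnv d Λ Q m B u j s' → SearchRep ((step Q B u j)^[k] σ) k s' →
      ((BExp.and (.ile (.lit 1) (ivar 15)) (.rle (.mul (.ofInt (.add (ivar 17) (.lit 1)))
        (.ofInt (ivar 6))) (.ofInt (.get 0 (.lit 2))))).eval s' ↔
        0 < ((step Q B u j)^[k] σ).depth ∧ k + 1 ≤ Λ / m) := by
    intro k s' h1 h2
    simp only [BExp.eval, IExp.eval, RExp.eval, h2.depth, h2.rounds, h1.shifts, h1.cap]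
    rw [Nat.le_div_iff_mul_le hm]
    refine and_congr (by omega) ?_
    exact_mod_cast Iff.rfl
  refine Runs.mono (Runs.loop (N := min τ (Λ / m)) (C := 220 * (d + 1)) (I := fun k s' =>
    SearchEnv d Λ Q m B u j s' ∧ SearchRep ((step Q B u j)^[k] σ) k s') ?_ ?_ ?_) ?_ ?_
  · rintro k s' hk ⟨h1, h2⟩
    refine ⟨(hguard k s' h1 h2).2 ⟨hex.lt_depth k (by omega), by omega⟩, ?_⟩
    rw [Function.iterate_succ_apply']
    exact searchRound_runs h1 h2 (hex.lt_depth k (by omega)) (hsound k (by omega)).depth_le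
  · rintro s' ⟨h1, h2⟩ hb
    obtain ⟨h3, h4⟩ := (hguard _ s' h1 h2).1 hb
    rcases Nat.le_total τ (Λ / m) with h | h
    · rw [min_eq_left h, hex.depth_eq] at h3
      exact lt_irrefl _ h3
    · omega
  · exact ⟨hE, by simp [hσ, hdepth], by simpa using hrounds, by simp [hσ], by simp [hσ], hL⟩
  · have h1 : min τ (Λ / m) ≤ Λ / m := min_le_right _ _
    refine Nat.add_le_add (Nat.mul_le_mul h1 ?_) ?_ <;> simp [BExp.cost, IExp.cost, RExp.cost]
    omega
  · rintro s' _ - ⟨h1, h2⟩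
    obtain ⟨L', hL', hS⟩ := (hsound _ (min_le_left _ _)).out
    have hlen := length_out_iterate (Q := Q) (B := B) (u := u) (j := j) σ (min τ (Λ / m))
    refine ⟨L', hL' ▸ h2.out, hS, ?_, ?_, ?_⟩
    · rw [hL', List.length_append] at hlen
      simp only [hσ] at hlen
      omega
    · intro hg v hv
      rw [← hL', min_eq_left (hgood.1 hg)]
      exact hex.complete v (by simp) (by simpa using hv)
    · rw [h2.depth, hgood]
      constructor
      · intro h
        by_contra hlt
        have := hex.lt_depth (min τ (Λ / m)) (by omega)
        omega
      · intro h
        rw [min_eq_left h, hex.depth_eq]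
        simp

/-- Coordinate `i` of the point `x` in the grid of shift `j`, in which the cells are unit cubes. -/
def shiftedCoord (d : ℕ) (κ : ℝ) (x : ℕ → ℤ) (S : ℕ → ℝ) (j i : ℕ) : ℝ :=
  x i * κ + S (j * d + i)

/-- The quantities that are fixed during a query. -/
structure QueryEnv (d Λ Q m : ℕ) (κ B : ℝ) (x : ℕ → ℤ) (S : ℕ → ℝ) (s : State) : Prop where
  dim : s.ints 0 0 = d
  cap : s.ints 0 2 = Λ
  width : s.ints 5 0 = Q
  shifts : s.ints 6 0 = m
  point : ∀ i < d, s.ints 1 (i : ℤ) = x i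
  table : ∀ n < m * d, s.reals 1 (n : ℤ) = S n
  scale : s.reals 2 0 = κ
  radius : s.reals 4 0 = B

variable {κ : ℝ} {x : ℕ → ℤ} {S : ℕ → ℝ}

theorem QueryEnv.congr {s s' : State} (h : QueryEnv d Λ Q m κ B x S s)
    (hi : ∀ a ∈ [0, 1, 5, 6], s'.ints a = s.ints a)
    (hr : ∀ a ∈ [1, 2, 4], s'.reals a = s.reals a) : QueryEnv d Λ Q m κ B x S s' := by
  have h0 := hi 0 (by decide)
  have h1 := hi 1 (by decide)
  have h5 := hi 5 (by decide)
  have h6 := hi 6 (by decide)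
  have r1 := hr 1 (by decide)
  have r2 := hr 2 (by decide)
  have r4 := hr 4 (by decide)
  obtain ⟨a1, a2, a3, a4, a5, a6, a7, a8⟩ := h
  constructor <;> simp_all

theorem Runs.floor {s : State} {a : ℕ} {i : IExp} {e : RExp} {b : ℕ} {P : State → Prop}
    (hb : Nat.size ⌊e.eval s⌋.natAbs ≤ b) (h : P (s.setI a (i.eval s) ⌊e.eval s⌋)) :
    Runs (.floor a i e) s (i.cost + e.cost + b + 1) P :=
  ⟨_, _, .floor s a i e, by omega, h⟩

theorem locate_runs {s : State} {k b : ℕ} (hE : QueryEnv d Λ Q m κ B x S s) (hk : k < m)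
    (hpos : s.ints 12 0 = (k * d : ℕ))
    (hb : ∀ i < d, Nat.size ⌊shiftedCoord d κ x S k i⌋.natAbs ≤ b) :
    Runs locate s (d * (60 + b) + 20) fun s' => ∀ i < d,
      s'.reals 5 (i : ℤ) = shiftedCoord d κ x S k i ∧
      s'.ints 14 (i : ℤ) = ⌊shiftedCoord d κ x S k i⌋ := by
  set u := shiftedCoord d κ x S k with hu
  unfold locate
  refine Runs.mono (Runs.seq (Runs.of_straight rfl (Runs.mono (Runs.loop (N := d) (C := 40 + b)
    (I := fun i s' => QueryEnv d Λ Q m κ B x S s' ∧ s'.ints 12 0 = (k * d : ℕ) ∧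
      s'.ints 13 0 = i ∧ ∀ n < i, s'.reals 5 (n : ℤ) = u n ∧ s'.ints 14 (n : ℤ) = ⌊u n⌋)
    ?_ ?_ ?_) le_rfl fun s' _ _ h => h.2.2.2))) ?_ fun _ _ _ h => h
  · rintro i s' hi ⟨h1, h2, h3, h4⟩
    refine ⟨by simp [BExp.eval, IExp.eval, h1.dim, h3, hi], ?_⟩
    have hval : s'.ints 1 (i : ℤ) * s'.reals 2 0 + s'.reals 1 ((k * d : ℕ) + (i : ℤ)) = u i := by
      rw [h1.point i hi, h1.scale, hu, shiftedCoord]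
      congr 1
      have hlt : k * d + i < m * d := by
        have := Nat.mul_le_mul_right d (Nat.succ_le_of_lt hk)
        rw [Nat.succ_mul] at this
        omega
      exact_mod_cast h1.table _ hlt
    refine Runs.mono (Q := fun s'' => s''.ints 13 0 = (i + 1 : ℕ) ∧
      ∀ n < i + 1, s''.reals 5 (n : ℤ) = u n ∧ s''.ints 14 (n : ℤ) = ⌊u n⌋)
      (Runs.seq (Runs.of_straight rfl (Runs.seq (Runs.floor (b := b) ?_
        (Runs.of_straight rfl ?_))))) ?_ ?_
    · simp only [Cmd.run, RExp.eval, IExp.eval, State.setR_ints, State.setR_reals, h2, h3,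
        and_self, if_true, hval]
      exact hb i hi
    · simp only [Cmd.run, RExp.eval, IExp.eval, State.setR_ints, State.setR_reals,
        State.setI_ints, State.setI_reals, h2, h3, and_self, if_true, hval]
      refine ⟨by simp, fun n hn => ?_⟩
      rcases Nat.lt_succ_iff_lt_or_eq.1 hn with hn | rfl
      · have : (n : ℤ) ≠ i := by omega
        simpa [this] using h4 n hn
      · simp
    · simp [Cmd.bound, IExp.cost, RExp.cost]
      omega
    · rintro s'' _ he ⟨h5, h6⟩
      exact ⟨h1.congr (fun a ha => he.ints_eq (by fin_cases ha <;> rfl))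
        fun a ha => he.reals_eq (by fin_cases ha <;> rfl),
        by rw [he.ints_eq (by rfl), h2], h5, h6⟩
  · rintro s' ⟨h1, -, h3, -⟩
    simp [BExp.eval, IExp.eval, h1.dim, h3]
  · simp only [Cmd.run, IExp.eval]
    refine ⟨hE.congr (fun a ha => ?_) fun a _ => rfl, by simpa [State.setI_ints] using hpos,
      by simp [State.setI_ints], by simp⟩
    funext n
    have : a ≠ 13 := by rintro rfl; simp at ha
    simp [State.setI_ints, this]
  · simp only [Cmd.bound, IExp.cost, BExp.cost]
    have : d * (1 + 1 + (1 + 1) + 1 + 1 + (40 + b) + 1) ≤ d * (60 + b) :=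
      Nat.mul_le_mul_left d (by omega)
    omega

/-- The value of the hash function is known to be the cell and number of the first good shift among
the first `k`, or none of these is good. -/
def ValueRep (d Λ Q m : ℕ) (κ B : ℝ) (x : ℕ → ℤ) (S : ℕ → ℝ) (k : ℕ) (s : State) : Prop :=
  (s.ints 19 0 = 0 ∧ ∀ i < k, ¬ Good d Λ Q m B (shiftedCoord d κ x S i)) ∨
  (s.ints 19 0 = 1 ∧ ∃ J < k, Good d Λ Q m B (shiftedCoord d κ x S J) ∧
    (∀ i < J, ¬ Good d Λ Q m B (shiftedCoord d κ x S i)) ∧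
    s.outValue d = encode d (fun i => ⌊shiftedCoord d κ x S J i⌋) J)

theorem recordValue_runs {s : State} {k : ℕ} (hd : s.ints 0 0 = d) (hj : s.ints 11 0 = k)
    (hcell : ∀ i < d, s.ints 14 (i : ℤ) = ⌊shiftedCoord d κ x S k i⌋)
    (hgood : s.ints 15 0 ≤ 0 ↔ Good d Λ Q m B (shiftedCoord d κ x S k))
    (hV : ValueRep d Λ Q m κ B x S k s) :
    Runs recordValue s (80 * (d + 1)) fun s' => ValueRep d Λ Q m κ B x S (k + 1) s' := by
  unfold recordValue
  refine Runs.mono (Runs.ite (T := 60 * (d + 1)) (fun hb => ?_) fun hb => ?_) ?_ fun _ _ _ h => h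
  · simp only [BExp.eval, IExp.eval] at hb
    have hg := hgood.1 hb.1
    have hnot : ∀ i < k, ¬ Good d Λ Q m B (shiftedCoord d κ x S i) := by
      rcases hV with h | h
      · exact h.2
      · exact absurd hb.2 (by rw [h.1]; decide)
    refine Runs.mono (Runs.seq (Runs.of_straight rfl (Runs.seq (Runs.mono (Runs.loop (N := d)
      (C := 20) (I := fun c s' => (∀ a, a ≠ 2 → a ≠ 20 → s'.ints a = s.ints a) ∧
        s'.ints 20 0 = c ∧ ∀ i < c, s'.ints 2 (i : ℤ) = ⌊shiftedCoord d κ x S k i⌋) ?_ ?_ ?_)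
      le_rfl fun s' _ _ hs' => Runs.of_straight rfl ?_)))) ?_ fun _ _ _ h => h
    · rintro c s' hc ⟨h1, h2, h3⟩
      have h0 : s'.ints 0 0 = d := by rw [h1 0 (by decide) (by decide), hd]
      have h14 : s'.ints 14 (c : ℤ) = ⌊shiftedCoord d κ x S k c⌋ := by
        rw [h1 14 (by decide) (by decide), hcell c hc]
      refine ⟨by simp [BExp.eval, IExp.eval, h0, h2, hc], Runs.mono (Runs.of_straight rfl
        (Q := fun s'' => _) ?_) (by decide) fun _ _ _ h => h⟩
      simp only [Cmd.run, IExp.eval, State.setI_ints, h2, h14]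
      refine ⟨?_, by simp, ?_⟩
      · intro a a2 a20
        funext n
        simp [State.setI_ints, a2, a20, h1 a a2 a20]
      · intro i hi
        rcases Nat.lt_succ_iff_lt_or_eq.1 hi with hi | rfl
        · have : (i : ℤ) ≠ c := by omega
          simpa [this] using h3 i hi
        · simp
    · rintro s' ⟨h1, h2, -⟩
      have h0 : s'.ints 0 0 = d := by rw [h1 0 (by decide) (by decide), hd]
      simp [BExp.eval, IExp.eval, h0, h2]
    · simp only [Cmd.run, IExp.eval]
      refine ⟨fun a _ a20 => ?_, by simp [State.setI_ints], by simp⟩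
      funext n
      simp [State.setI_ints, a20]
    · obtain ⟨h1, -, h3⟩ := hs'
      have h0 : s'.ints 0 0 = d := by rw [h1 0 (by decide) (by decide), hd]
      have h11 : s'.ints 11 0 = k := by rw [h1 11 (by decide) (by decide), hj]
      refine Or.inr ⟨by simp [Cmd.run, IExp.eval, State.setI_ints], k, by omega, hg, hnot, ?_⟩
      funext t
      have ht := t.2
      simp only [State.outValue, Cmd.run, IExp.eval, State.setI_ints, h0, h11, encode]
      by_cases htd : (t : ℕ) < d
      · have : ((t : ℕ) : ℤ) ≠ d := by omega
        simpa [this, htd] using h3 t htd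
      · have : (t : ℕ) = d := by omega
        simp [this]
    · simp only [Cmd.bound, IExp.cost, BExp.cost]
      omega
  · refine ⟨s, 1, .skip s, by omega, ?_⟩
    simp only [BExp.eval, IExp.eval, not_and] at hb
    rcases hV with ⟨h1, h2⟩ | ⟨h1, J, hJ, h2⟩
    · refine Or.inl ⟨h1, fun i hi => ?_⟩
      rcases Nat.lt_succ_iff_lt_or_eq.1 hi with hi | rfl
      · exact h2 i hi
      · intro hg
        exact hb (hgood.2 hg) (by omega)
    · exact Or.inr ⟨h1, J, by omega, h2⟩
  · simp only [BExp.cost, IExp.cost]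
    omega

/-- The output list after the first `k` shifts. It may list cells of shifts in which the search was
abandoned, but it is complete for the good shifts. -/
structure ListSpec (d Λ Q m : ℕ) (κ B : ℝ) (x : ℕ → ℤ) (S : ℕ → ℝ) (k : ℕ)
    (L : List (Fin (d + 1) → ℤ)) : Prop where
  length_le : L.length ≤ k * (Λ / m)
  sound : ∀ z ∈ L, ∃ i < k, ∃ v : ℕ → ℤ, z = encode d v i ∧
    ∑ n ∈ Finset.range d, cellDist (shiftedCoord d κ x S i n) (v n) ^ 2 ≤ B
  complete : ∀ i < k, Good d Λ Q m B (shiftedCoord d κ x S i) → ∀ v : ℕ → ℤ,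
    ∑ n ∈ Finset.range d, cellDist (shiftedCoord d κ x S i n) (v n) ^ 2 ≤ B → encode d v i ∈ L

/-- The invariant of a query after the treatment of `k` shifts. -/
structure ScanRep (d Λ Q m : ℕ) (κ B : ℝ) (x : ℕ → ℤ) (S : ℕ → ℝ) (k : ℕ) (s : State) :
    Prop where
  env : QueryEnv d Λ Q m κ B x S s
  shift : s.ints 11 0 = k
  pos : s.ints 12 0 = (k * d : ℕ)
  value : ValueRep d Λ Q m κ B x S k s
  list : ∃ L : List (Fin (d + 1) → ℤ), OutRep L s ∧ ListSpec d Λ Q m κ B x S k L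

theorem scanRound_runs {s : State} {k b : ℕ} (hs : ScanRep d Λ Q m κ B x S k s) (hk : k < m)
    (hd : 1 ≤ d) (hB0 : 0 ≤ B) (hB : B < (Q : ℝ) ^ 2)
    (hb : ∀ i < d, Nat.size ⌊shiftedCoord d κ x S k i⌋.natAbs ≤ b) :
    Runs scanRound s (d * (60 + b) + Λ / m * (250 * (d + 1)) + 80 * (d + 1) + 200)
      (ScanRep d Λ Q m κ B x S (k + 1)) := by
  obtain ⟨hE, hshift, hpos, hV, L, hL, hspec⟩ := hs
  set u := shiftedCoord d κ x S k with hu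
  unfold scanRound
  refine Runs.mono (Q := fun s' => s'.ints 11 0 = (k + 1 : ℕ) ∧ s'.ints 12 0 = ((k + 1) * d : ℕ) ∧
    ValueRep d Λ Q m κ B x S (k + 1) s' ∧
    ∃ L : List (Fin (d + 1) → ℤ), OutRep L s' ∧ ListSpec d Λ Q m κ B x S (k + 1) L)
    (Runs.seq (T₂ := Λ / m * (250 * (d + 1)) + 80 * (d + 1) + 180)
      (Runs.mono (locate_runs hE hk hpos hb) le_rfl fun s₁ _ he₁ h₁ => ?_)) (by omega) ?_
  · obtain ⟨s₂, hs₂⟩ : ∃ s₂, s₂ = searchInit.run s₁ := ⟨_, rfl⟩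
    have hi₁ : ∀ a ∈ [0, 2, 3, 4, 5, 6, 11, 12, 18, 19], s₁.ints a = s.ints a :=
      fun a ha => he₁.ints_eq (by fin_cases ha <;> rfl)
    have hi₂ : ∀ a ∈ [0, 2, 3, 4, 5, 6, 11, 12, 14, 18, 19], s₂.ints a = s₁.ints a := by
      intro a ha
      funext n
      rw [hs₂]
      fin_cases ha <;> simp [searchInit, Cmd.run, State.setI_ints, State.setR_ints]
    have hi : ∀ a ∈ [0, 2, 3, 4, 5, 6, 11, 12, 18, 19], s₂.ints a = s.ints a := fun a ha => by
      rw [hi₂ a (by fin_cases ha <;> decide), hi₁ a ha]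
    have hE₂ : SearchEnv d Λ Q m B u k s₂ := by
      refine ⟨by rw [hi 0 (by decide), hE.dim], by rw [hi 0 (by decide), hE.cap],
        by rw [hi 5 (by decide), hE.width], by rw [hi 6 (by decide), hE.shifts],
        by rw [hi 11 (by decide), hshift], fun i hi' => ?_, fun i hi' => ?_, ?_⟩
      · rw [hi₂ 14 (by decide), (h₁ i hi').2]
      · rw [hu, ← (h₁ i hi').1, hs₂]
        simp [searchInit, Cmd.run, State.setR_reals]
      · rw [← hE.radius, hs₂, ← he₁.reals_eq (a := 4) rfl]
        simp [searchInit, Cmd.run, State.setR_reals]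
    have hL₂ : OutRep L s₂ := hL.congr fun a ha => hi a (by fin_cases ha <;> decide)
    have h14 : s₁.ints 14 0 = ⌊u 0⌋ := by simpa using (h₁ 0 (by omega)).2
    have h5 : s₁.ints 5 0 = Q := by rw [hi₁ 5 (by decide), hE.width]
    refine Runs.mono (Runs.seq (T₂ := Λ / m * (250 * (d + 1)) + 80 * (d + 1) + 150)
      (Runs.of_straight rfl ?_)) ?_ fun _ _ _ h => h
    · rw [← hs₂]
      refine Runs.mono (Runs.seq (T₂ := 80 * (d + 1) + 100) (Runs.mono
        (searchLoop_runs hE₂ hB0 hB (by omega) ?_ ?_ ?_ ?_ hL₂) le_rfl fun s₃ _ he₃ h₃ => ?_))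
        (by omega) fun _ _ _ h => h
      · simp [hs₂, searchInit, Cmd.run, State.setI_ints, IExp.eval]
      · simp [hs₂, searchInit, Cmd.run, State.setI_ints, IExp.eval]
      · simp [hs₂, searchInit, Cmd.run, State.setI_ints, IExp.eval, State.setR_ints, h14, h5]
      · simp [hs₂, searchInit, Cmd.run, State.setR_reals, IExp.eval, RExp.eval]
      obtain ⟨L', hL', hS, hlen, hcomp, hgood⟩ := h₃
      have hi₃ : ∀ a ∈ [0, 2, 11, 12, 19], s₃.ints a = s.ints a := fun a ha => by
        rw [he₃.ints_eq (by fin_cases ha <;> rfl), hi a (by fin_cases ha <;> decide)]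
      have hV₃ : ValueRep d Λ Q m κ B x S k s₃ := by
        unfold ValueRep State.outValue at hV ⊢
        rw [hi₃ 19 (by decide), hi₃ 2 (by decide)]
        exact hV
      refine Runs.mono (Runs.seq (Runs.mono (recordValue_runs (k := k) ?_ ?_ ?_ hgood hV₃) le_rfl
        fun s₄ _ he₄ h₄ => Runs.of_straight rfl ?_)) ?_ fun _ _ _ h => h
      · rw [hi₃ 0 (by decide), hE.dim]
      · rw [hi₃ 11 (by decide), hshift]
      · intro i hi'
        rw [he₃.ints_eq (by rfl), hE₂.cell i hi']
      · have e0 : s₄.ints 0 0 = d := by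
          rw [he₄.ints_eq (by rfl), hi₃ 0 (by decide), hE.dim]
        have e11 : s₄.ints 11 0 = k := by rw [he₄.ints_eq (by rfl), hi₃ 11 (by decide), hshift]
        have e12 : s₄.ints 12 0 = (k * d : ℕ) := by
          rw [he₄.ints_eq (by rfl), hi₃ 12 (by decide), hpos]
        refine ⟨?_, ?_, ?_, L ++ L', ?_, ?_, ?_, ?_⟩
        · simp [Cmd.run, State.setI_ints, IExp.eval, e11]
        · simp [Cmd.run, State.setI_ints, IExp.eval, e12, e0]; ring
        · unfold ValueRep State.outValue at h₄ ⊢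
          simpa [Cmd.run, State.setI_ints, IExp.eval] using h₄
        · refine (hL'.congr (s' := s₄) fun a ha =>
            he₄.ints_eq (by fin_cases ha <;> rfl)).congr fun a ha => ?_
          funext n
          fin_cases ha <;> simp [Cmd.run, State.setI_ints]
        · rw [List.length_append, Nat.succ_mul]
          exact Nat.add_le_add hspec.length_le hlen
        · intro z hz
          rcases List.mem_append.1 hz with hz | hz
          · obtain ⟨i, hi', v, hv⟩ := hspec.sound z hz
            exact ⟨i, by omega, v, hv⟩
          · obtain ⟨v, hv⟩ := hS z hz
            exact ⟨k, by omega, v, hv⟩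
        · intro i hi' hg v hv
          rcases Nat.lt_succ_iff_lt_or_eq.1 hi' with hi' | rfl
          · exact List.mem_append_left _ (hspec.complete i hi' hg v hv)
          · exact hcomp hg v hv
      · simp only [Cmd.bound, IExp.cost]
        omega
    · simp only [searchInit, Cmd.bound, IExp.cost, RExp.cost]
      omega
  · rintro s' _ he ⟨h1, h2, h3, h4⟩
    exact ⟨hE.congr (fun a ha => he.ints_eq (by fin_cases ha <;> rfl))
      fun a ha => he.reals_eq (by fin_cases ha <;> rfl), h1, h2, h3, h4⟩

/-- Correctness of the query program. -/
theorem scan_runs {s : State} {b f : ℕ} {R : ℝ} (hd : s.ints 0 0 = d) (hΛ : s.ints 0 2 = Λ)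
    (hQ : s.ints 5 0 = Q) (hm : s.ints 6 0 = m) (hx : ∀ i < d, s.ints 1 (i : ℤ) = x i)
    (hS : ∀ n < m * d, s.reals 1 (n : ℤ) = S n) (hκ : s.reals 2 0 = κ) (hR : s.reals 3 0 = R)
    (hd1 : 1 ≤ d) (hR0 : 0 ≤ R) (hRQ : f * R < Q)
    (hb : ∀ k < m, ∀ i < d, Nat.size ⌊shiftedCoord d κ x S k i⌋.natAbs ≤ b) :
    Runs (scan f) s
      (m * (d * (60 + b) + Λ / m * (250 * (d + 1)) + 80 * (d + 1) + 210) + 80) fun s' =>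
      ValueRep d Λ Q m κ ((f * R) ^ 2) x S m s' ∧ ∃ L : List (Fin (d + 1) → ℤ),
        s'.outSet d = L.toFinset ∧ ListSpec d Λ Q m κ ((f * R) ^ 2) x S m L := by
  unfold scan
  have hB : ((f : ℝ) * R) ^ 2 < (Q : ℝ) ^ 2 := pow_lt_pow_left₀ hRQ (by positivity) two_ne_zero
  refine Runs.mono (Runs.seq (Runs.of_straight rfl (Runs.loop (N := m)
    (I := ScanRep d Λ Q m κ ((f * R) ^ 2) x S) (fun k s' hk hs' => ⟨?_,
      scanRound_runs hs' hk hd1 (sq_nonneg _) hB (hb k hk)⟩) ?_ ?_))) ?_ ?_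
  · simp [BExp.eval, IExp.eval, hs'.shift, hs'.env.shifts, hk]
  · intro s' hs'
    simp [BExp.eval, IExp.eval, hs'.shift, hs'.env.shifts]
  · simp only [scanInit, Cmd.run, RExp.eval, IExp.eval, hR]
    refine ⟨⟨?_, ?_, ?_, ?_, ?_, ?_, ?_, ?_⟩, ?_, ?_, Or.inl ⟨?_, ?_⟩, [], ⟨?_, ?_, ?_⟩, ?_, ?_, ?_⟩
    all_goals simp [State.setI_ints, State.setR_reals, hd, hΛ, hQ, hm, hκ, pow_two]
    · exact hx
    · exact_mod_cast hS
  · simp only [scanInit, Cmd.bound, RExp.cost, IExp.cost, BExp.cost]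
    have : ∀ c, m * (1 + 1 + (1 + 1) + 1 + 1 + c + 1) ≤ m * (c + 10) := fun c =>
      Nat.mul_le_mul_left m (by omega)
    refine le_trans (Nat.add_le_add_left (Nat.add_le_add_right (this _) _) _) ?_
    rw [show d * (60 + b) + Λ / m * (250 * (d + 1)) + 80 * (d + 1) + 200 + 10 =
      d * (60 + b) + Λ / m * (250 * (d + 1)) + 80 * (d + 1) + 210 by ring]
    omega
  · rintro s' _ - hs'
    obtain ⟨L, h1, h2⟩ := hs'.list
    exact ⟨hs'.value, L, h1.outSet_eq, h2⟩

end RealRAM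

/-! ### The sampling program -/

namespace RealRAM
open CellSearch

/-- Computes the least `q` with `d ≤ q ^ 2` in integer array `5`. -/
def rootLoop : Cmd :=
  .loop (.not (.rle (.ofInt (ivar 0)) (.mul (.ofInt (ivar 5)) (.ofInt (ivar 5))))) (incr 5)

/-- Computes `(e + 1) * Nat.clog 2 Δ` in integer array `7`. -/
def logLoop (e : ℕ) : Cmd :=
  .seq (assign 8 (.lit 1)) <|
  .loop (ilt (ivar 8) (.get 0 (.lit 1)))
    (.seq (assign 8 (.add (ivar 8) (ivar 8))) (assign 7 (.add (ivar 7) (.lit (e + 1)))))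

/-- Adds the variable `c` to the variable `a`, as often as the variable `b` says, with counter
`i`. -/
def addLoop (a i b c : ℕ) : Cmd :=
  .loop (ilt (ivar i) (ivar b)) (.seq (assign a (.add (ivar a) (ivar c))) (incr i))

/-- Fills the table of shifts. -/
def drawLoop : Cmd :=
  .loop (ilt (ivar 13) (ivar 9)) (.seq (.rand 1 (ivar 13)) (incr 13))

/-- Computes the reciprocal of the cell width, for bucket diameter `max ρ (1 / 4)`, and the scaled
radius `q / Γ`. -/
def scaleProg : Cmd :=
  let q : RExp := .ofInt (ivar 5)
  let quarter : RExp := .div (.ofInt (.lit 1)) (.ofInt (.lit 4))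
  .seq (.ite (.rle (.get 0 (.lit 1)) quarter) (.setR 2 (.lit 0) (.div q quarter))
    (.setR 2 (.lit 0) (.div q (.get 0 (.lit 1))))) <|
  .setR 3 (.lit 0) (.div q (rvar 0))

/-- The sampling program: it draws `d * (Nat.clog 2 Δ * (e + 1))` shifts with `d` coordinates each.
The number of shifts is left in integer array `6`, the number of random reals in integer array `9`;
the integer arrays `8`, `10`, `12` and `13` are auxiliary. -/
def sample (e : ℕ) : Cmd :=
  .seq rootLoop <| .seq (logLoop e) <| .seq (addLoop 6 10 0 7) <| .seq (addLoop 9 12 6 0) <|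
  .seq drawLoop scaleProg

theorem rootLoop_runs {d : ℕ} {s : State} (hd : s.ints 0 0 = d) (h5 : s.ints 5 0 = 0) :
    Runs rootLoop s (⌈√(d : ℝ)⌉₊ * 30 + 20) fun s' => s'.ints 5 0 = ⌈√(d : ℝ)⌉₊ := by
  have hguard : ∀ (n : ℕ) (s' : State), s'.ints 0 0 = (d : ℤ) → s'.ints 5 0 = n →
      ((BExp.not (.rle (.ofInt (ivar 0)) (.mul (.ofInt (ivar 5)) (.ofInt (ivar 5))))).eval s' ↔
        n < ⌈√(d : ℝ)⌉₊) := by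
    intro n s' h1 h2
    simp only [BExp.eval, RExp.eval, IExp.eval, h1, h2, not_le, Int.cast_natCast]
    rw [Nat.lt_ceil, Real.lt_sqrt (Nat.cast_nonneg n), pow_two]
  refine Runs.mono (Runs.loop (N := ⌈√(d : ℝ)⌉₊) (C := 10)
    (I := fun n s' => s'.ints 0 0 = d ∧ s'.ints 5 0 = n) ?_ ?_ ⟨hd, h5⟩) ?_ fun _ _ _ h => h.2
  · rintro n s' hn ⟨h1, h2⟩
    refine ⟨(hguard n s' h1 h2).2 hn, Runs.mono (Runs.of_straight rfl (Q := fun s'' => _) ?_)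
      (by decide) fun _ _ _ h => h⟩
    simp [Cmd.run, IExp.eval, State.setI_ints, h1, h2]
  · rintro s' ⟨h1, h2⟩ hb
    exact lt_irrefl _ ((hguard _ s' h1 h2).1 hb)
  · simp only [BExp.cost, RExp.cost, IExp.cost]
    omega

theorem logLoop_runs {Δ e : ℕ} {s : State} (hΔ : s.ints 0 1 = Δ) (h7 : s.ints 7 0 = 0) :
    Runs (logLoop e) s (Nat.clog 2 Δ * 40 + 20) fun s' =>
      s'.ints 7 0 = (Nat.clog 2 Δ * (e + 1) : ℕ) := by
  have hguard : ∀ (n : ℕ) (s' : State), s'.ints 0 1 = (Δ : ℤ) → s'.ints 8 0 = (2 ^ n : ℕ) →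
      ((ilt (ivar 8) (.get 0 (.lit 1))).eval s' ↔ n < Nat.clog 2 Δ) := by
    intro n s' h1 h2
    simp only [BExp.eval, IExp.eval, h1, h2, not_le]
    rw [Nat.lt_clog_iff_pow_lt (by norm_num)]
    exact_mod_cast Iff.rfl
  unfold logLoop
  refine Runs.mono (Runs.seq (Runs.of_straight rfl (Runs.loop (N := Nat.clog 2 Δ) (C := 20)
    (I := fun n s' => s'.ints 0 1 = Δ ∧ s'.ints 8 0 = (2 ^ n : ℕ) ∧
      s'.ints 7 0 = (n * (e + 1) : ℕ)) ?_ ?_ ?_))) ?_ fun _ _ _ h => h.2.2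
  · rintro n s' hn ⟨h1, h2, h3⟩
    refine ⟨(hguard n s' h1 h2).2 hn, Runs.mono (Runs.of_straight rfl (Q := fun s'' => _) ?_)
      (by simp [Cmd.bound, IExp.cost]) fun _ _ _ h => h⟩
    simp only [Cmd.run, IExp.eval]
    refine ⟨?_, ?_, ?_⟩
    · simp [State.setI_ints, h1]
    · simp [State.setI_ints, h2]; ring
    · simp [State.setI_ints, h3]; ring
  · rintro s' ⟨h1, h2, -⟩ hb
    exact lt_irrefl _ ((hguard _ s' h1 h2).1 hb)
  · simp [Cmd.run, State.setI_ints, IExp.eval, hΔ, h7]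
  · simp only [Cmd.bound, BExp.cost, IExp.cost]
    omega

theorem addLoop_runs {a i b c n v : ℕ} {s : State} (hai : a ≠ i) (hab : b ≠ a) (hac : c ≠ a)
    (hib : b ≠ i) (hic : c ≠ i) (ha : s.ints a 0 = 0) (hi : s.ints i 0 = 0)
    (hb : s.ints b 0 = n) (hc : s.ints c 0 = v) :
    Runs (addLoop a i b c) s (n * 40 + 20) fun s' => s'.ints a 0 = (n * v : ℕ) := by
  unfold addLoop
  refine Runs.mono (Runs.loop (N := n) (C := 20)
    (I := fun k s' => s'.ints b 0 = n ∧ s'.ints c 0 = v ∧ s'.ints i 0 = k ∧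
      s'.ints a 0 = (k * v : ℕ)) ?_ ?_ ⟨hb, hc, hi, by simpa using ha⟩) ?_ fun _ _ _ h => h.2.2.2
  · rintro k s' hk ⟨h1, h2, h3, h4⟩
    refine ⟨by simp [BExp.eval, IExp.eval, h1, h3, hk], Runs.mono (Runs.of_straight rfl
      (Q := fun s'' => _) ?_) (by simp [Cmd.bound, IExp.cost]) fun _ _ _ h => h⟩
    simp only [Cmd.run, IExp.eval]
    refine ⟨?_, ?_, ?_, ?_⟩
    · simp [State.setI_ints, h1, hab, hib]
    · simp [State.setI_ints, h2, hac, hic]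
    · simp [State.setI_ints, h3, hai.symm]
    · simp [State.setI_ints, h4, h2, hai]; ring
  · rintro s' ⟨h1, -, h3, -⟩
    simp [BExp.eval, IExp.eval, h1, h3]
  · simp only [BExp.cost, IExp.cost]
    omega

theorem drawLoop_runs {N : ℕ} {s : State} (h9 : s.ints 9 0 = N) (h13 : s.ints 13 0 = 0) :
    Runs drawLoop s (N * 40 + 20) fun s' => ∀ n < N, s'.reals 1 (n : ℤ) = s.tape n := by
  unfold drawLoop
  refine Runs.mono (Runs.loop (N := N) (C := 20)
    (I := fun k s' => s'.ints 9 0 = N ∧ s'.ints 13 0 = k ∧ (∀ n, s'.tape n = s.tape (k + n)) ∧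
      ∀ n < k, s'.reals 1 (n : ℤ) = s.tape n) ?_ ?_ ⟨h9, h13, by simp, by simp⟩) ?_
    fun _ _ _ h => h.2.2.2
  · rintro k s' hk ⟨h1, h2, h3, h4⟩
    refine ⟨by simp [BExp.eval, IExp.eval, h1, h2, hk], Runs.mono (Runs.seq
      (Q := fun s'' => _) ⟨_, _, .rand s' 1 (ivar 13), le_rfl, Runs.of_straight rfl ?_⟩)
      (by decide) fun _ _ _ h => h⟩
    simp only [Cmd.run, IExp.eval]
    refine ⟨by simpa [State.setI_ints] using h1, by simp [State.setI_ints, h2], ?_, ?_⟩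
    · intro n
      simp only [State.setI_tape, h3]
      congr 1
      ring
    · intro n hn
      simp only [State.setI_reals, State.setR_reals, h2, true_and]
      rcases Nat.lt_succ_iff_lt_or_eq.1 hn with hn | rfl
      · rw [if_neg (by omega), h4 n hn]
      · rw [if_pos rfl, h3, add_zero]
  · rintro s' ⟨h1, h2, -⟩
    simp [BExp.eval, IExp.eval, h1, h2]
  · simp only [BExp.cost, IExp.cost]
    omega

theorem scaleProg_runs {q : ℕ} {Γ ρ : ℝ} {s : State} (hq : s.ints 5 0 = q)
    (hΓ : s.reals 0 0 = Γ) (hρ : s.reals 0 1 = ρ) :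
    Runs scaleProg s 60 fun s' =>
      s'.reals 2 0 = q / max ρ (1 / 4) ∧ s'.reals 3 0 = q / Γ := by
  refine Runs.mono (Runs.of_straight rfl (Q := fun s' => _) ?_) (by decide) fun _ _ _ h => h
  simp only [scaleProg, Cmd.run, BExp.eval, RExp.eval, IExp.eval, hρ, Int.cast_one,
    Int.cast_ofNat]
  rcases le_total ρ (1 / 4) with h | h
  · rw [if_pos h, max_eq_right h]
    simp [State.setR_reals, hq, hΓ]
  · rw [max_eq_left h]
    split_ifs with h'
    · obtain rfl : ρ = 1 / 4 := le_antisymm h' h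
      simp [State.setR_reals, hq, hΓ]
    · simp [State.setR_reals, hq, hΓ]

/-- Correctness of the sampling program. -/
theorem sample_runs (d Δ Λ e : ℕ) (Γ ρ : ℝ) (ω : Tape) {m : ℕ}
    (hm : m = d * (Nat.clog 2 Δ * (e + 1))) :
    Runs (sample e) (startState d Δ Λ Γ ρ ω)
      (⌈√(d : ℝ)⌉₊ * 30 + Nat.clog 2 Δ * 40 + d * 40 + m * 40 + m * d * 40 + 160) fun s =>
      s.ints 0 0 = d ∧ s.ints 0 2 = Λ ∧ s.ints 5 0 = ⌈√(d : ℝ)⌉₊ ∧ s.ints 6 0 = m ∧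
      s.reals 2 0 = ⌈√(d : ℝ)⌉₊ / max ρ (1 / 4) ∧ s.reals 3 0 = ⌈√(d : ℝ)⌉₊ / Γ ∧
      ∀ n < m * d, s.reals 1 (n : ℤ) = ω n := by
  set s₀ := startState d Δ Λ Γ ρ ω with hs₀
  have z : ∀ a ≠ 0, s₀.ints a 0 = 0 := by
    intro a ha
    simp [hs₀, startState, ha]
  have hd : s₀.ints 0 0 = d := by simp [hs₀, startState]
  have hΔ : s₀.ints 0 1 = Δ := by simp [hs₀, startState]
  have hΛ : s₀.ints 0 2 = Λ := by simp [hs₀, startState]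
  have hΓ : s₀.reals 0 0 = Γ := by simp [hs₀, startState]
  have hρ : s₀.reals 0 1 = ρ := by simp [hs₀, startState]
  unfold sample
  refine Runs.mono (Runs.seq (Runs.mono (rootLoop_runs hd (z 5 (by decide))) le_rfl
    fun s₁ _ he₁ h₁ => Runs.seq (Runs.mono (logLoop_runs (e := e) (Δ := Δ) ?_ ?_) le_rfl
    fun s₂ _ he₂ h₂ => Runs.seq (Runs.mono (addLoop_runs (n := d) (v := Nat.clog 2 Δ * (e + 1))
      (by decide) (by decide) (by decide) (by decide) (by decide) ?_ ?_ ?_ ?_) le_rfl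
    fun s₃ _ he₃ h₃ => Runs.seq (Runs.mono (addLoop_runs (n := m) (v := d)
      (by decide) (by decide) (by decide) (by decide) (by decide) ?_ ?_ ?_ ?_) le_rfl
    fun s₄ _ he₄ h₄ => Runs.seq (Runs.mono (drawLoop_runs (N := m * d) ?_ ?_) le_rfl
    fun s₅ _ he₅ h₅ => Runs.mono (scaleProg_runs (q := ⌈√(d : ℝ)⌉₊) (Γ := Γ) (ρ := ρ) ?_ ?_ ?_)
      le_rfl fun s₆ _ he₆ h₆ => ?_)))))) ?_ fun _ _ _ h => h
  · rw [he₁.ints_eq (by rfl), hΔ]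
  · rw [he₁.ints_eq (by rfl), z 7 (by decide)]
  · rw [he₂.ints_eq (by rfl), he₁.ints_eq (by rfl), z 6 (by decide)]
  · rw [he₂.ints_eq (by rfl), he₁.ints_eq (by rfl), z 10 (by decide)]
  · rw [he₂.ints_eq (by rfl), he₁.ints_eq (by rfl), hd]
  · exact h₂
  · rw [he₃.ints_eq (by rfl), he₂.ints_eq (by rfl), he₁.ints_eq (by rfl), z 9 (by decide)]
  · rw [he₃.ints_eq (by rfl), he₂.ints_eq (by rfl), he₁.ints_eq (by rfl), z 12 (by decide)]
  · rw [h₃, hm]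
  · rw [he₃.ints_eq (by rfl), he₂.ints_eq (by rfl), he₁.ints_eq (by rfl), hd]
  · exact h₄
  · rw [he₄.ints_eq (by rfl), he₃.ints_eq (by rfl), he₂.ints_eq (by rfl), he₁.ints_eq (by rfl),
      z 13 (by decide)]
  · rw [he₅.ints_eq (by rfl), he₄.ints_eq (by rfl), he₃.ints_eq (by rfl), he₂.ints_eq (by rfl), h₁]
  · rw [he₅.reals_eq (by rfl), he₄.reals_eq (by rfl), he₃.reals_eq (by rfl),
      he₂.reals_eq (by rfl), he₁.reals_eq (by rfl), hΓ]
  · rw [he₅.reals_eq (by rfl), he₄.reals_eq (by rfl), he₃.reals_eq (by rfl),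
      he₂.reals_eq (by rfl), he₁.reals_eq (by rfl), hρ]
  · have h0 : s₆.ints 0 = s₀.ints 0 := by
      rw [he₆.ints_eq (by rfl), he₅.ints_eq (by rfl), he₄.ints_eq (by rfl), he₃.ints_eq (by rfl),
        he₂.ints_eq (by rfl), he₁.ints_eq (by rfl)]
    refine ⟨by rw [h0, hd], by rw [h0, hΛ], ?_, ?_, h₆.1, h₆.2, ?_⟩
    · rw [he₆.ints_eq (by rfl), he₅.ints_eq (by rfl), he₄.ints_eq (by rfl),
        he₃.ints_eq (by rfl), he₂.ints_eq (by rfl), h₁]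
    · rw [he₆.ints_eq (by rfl), he₅.ints_eq (by rfl), he₄.ints_eq (by rfl), h₃, hm]
    · intro n hn
      rw [he₆.reals_eq (by rfl), h₅ n hn, he₄.tape_eq (by rfl), he₃.tape_eq (by rfl),
        he₂.tape_eq (by rfl), he₁.tape_eq (by rfl)]
      simp [hs₀, startState]
  · omega

end RealRAM

/-! ### Geometry of the grid -/

namespace CellSearch

variable {d Δ : ℕ}

/-- The coordinates of a grid point as a sequence, continued by zeros. -/
def gridCoord (x : Grid d Δ) (i : ℕ) : ℤ := if h : i < d then x.1 ⟨i, h⟩ else 0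

theorem sum_sq_gridCoord (x y : Grid d Δ) :
    ∑ i ∈ Finset.range d, ((gridCoord x i : ℝ) - gridCoord y i) ^ 2 = dist x y ^ 2 := by
  have h : dist x y = dist x.pt y.pt := rfl
  rw [h, EuclideanSpace.dist_eq, Real.sq_sqrt (Finset.sum_nonneg fun _ _ => sq_nonneg _),
    Finset.sum_range]
  refine Finset.sum_congr rfl fun i _ => ?_
  rw [Real.dist_eq, sq_abs]
  simp [gridCoord, Grid.pt]

theorem eq_of_dist_lt_one {x y : Grid d Δ} (h : dist x y < 1) : x = y := by
  have h1 : ∑ i ∈ Finset.range d, ((gridCoord x i : ℝ) - gridCoord y i) ^ 2 < 1 := by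
    rw [sum_sq_gridCoord]
    have := dist_nonneg (x := x) (y := y)
    nlinarith
  apply Subtype.ext
  funext i
  have h2 : ((gridCoord x i : ℝ) - gridCoord y i) ^ 2 < 1 :=
    lt_of_le_of_lt (Finset.single_le_sum (f := fun i => ((gridCoord x i : ℝ) - gridCoord y i) ^ 2)
      (fun _ _ => sq_nonneg _) (Finset.mem_range.2 i.2)) h1
  simp only [gridCoord, i.2, dif_pos, Fin.eta] at h2
  have h3 : (x.1 i - y.1 i) ^ 2 < 1 := by exact_mod_cast h2
  have h4 : x.1 i - y.1 i = 0 := by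
    by_contra hne
    have : 0 < (x.1 i - y.1 i) ^ 2 := by positivity
    omega
  omega

/-- Distances below `1 / 2` vanish on the grid, so that the bucket diameter may be replaced by
`1 / 4` if it is smaller. -/
theorem dist_le_of_le_max {x y : Grid d Δ} {c ρ : ℝ} (hc : 0 ≤ c) (hc2 : c ≤ 2) (hρ : 0 < ρ)
    (h : dist x y ≤ c * max ρ (1 / 4)) : dist x y ≤ c * ρ := by
  rcases le_total ρ (1 / 4) with h1 | h1
  · rw [max_eq_right h1] at h
    rw [eq_of_dist_lt_one (lt_of_le_of_lt h (by linarith)), dist_self]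
    positivity
  · rwa [max_eq_left h1] at h

/-- A grid point as a function to `Fin Δ`. -/
def gridCode (x : Grid d Δ) (i : Fin d) : Fin Δ :=
  ⟨(x.1 i - 1).toNat, by have := x.2 i; omega⟩

theorem gridCode_injective : Function.Injective (gridCode : Grid d Δ → Fin d → Fin Δ) := by
  intro x y h
  apply Subtype.ext
  funext i
  have := congrArg Fin.val (congrFun h i)
  have hx := x.2 i
  have hy := y.2 i
  simp only [gridCode] at this
  omega

noncomputable instance : Fintype (Grid d Δ) := Fintype.ofInjective _ gridCode_injective

theorem card_grid_le : Fintype.card (Grid d Δ) ≤ Δ ^ d := by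
  simpa using Fintype.card_le_of_injective _ (gridCode_injective (d := d) (Δ := Δ))

end CellSearch

/-! ### The hash function -/

namespace RealRAM
open CellSearch

variable {d Δ Λ Q m : ℕ} {κ R : ℝ}

theorem sum_sq_shiftedCoord (κ : ℝ) (S : ℕ → ℝ) (j : ℕ) (x y : Grid d Δ) :
    ∑ i ∈ Finset.range d, (shiftedCoord d κ (gridCoord x) S j i -
      shiftedCoord d κ (gridCoord y) S j i) ^ 2 = (κ * dist x y) ^ 2 := by
  rw [mul_pow, ← sum_sq_gridCoord, Finset.mul_sum]
  refine Finset.sum_congr rfl fun i _ => ?_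
  simp only [shiftedCoord]
  ring

theorem exists_good_or_le (d Λ Q m : ℕ) (κ B : ℝ) (x : ℕ → ℤ) (S : ℕ → ℝ) :
    ∃ j, m ≤ j ∨ Good d Λ Q m B (shiftedCoord d κ x S j) := ⟨m, Or.inl le_rfl⟩

open Classical in
/-- The number of the first good shift, or `m` if there is none. -/
noncomputable def firstGood (d Λ Q m : ℕ) (κ B : ℝ) (x : ℕ → ℤ) (S : ℕ → ℝ) : ℕ :=
  Nat.find (exists_good_or_le d Λ Q m κ B x S)

/-- The hash function: the cell of the point in the first good shift, and the number of that
shift. -/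
noncomputable def hashValue (d Λ Q m : ℕ) (κ B : ℝ) (x : ℕ → ℤ) (S : ℕ → ℝ) : Fin (d + 1) → ℤ :=
  encode d (fun i => ⌊shiftedCoord d κ x S (firstGood d Λ Q m κ B x S) i⌋)
    (firstGood d Λ Q m κ B x S)

theorem measurableSet_hashValue_eq (d Λ Q m : ℕ) (κ B : ℝ) (x : ℕ → ℤ) (z : Fin (d + 1) → ℤ) :
    MeasurableSet {ω : Tape | hashValue d Λ Q m κ B x (fun n => ω n) = z} := by
  have hc : ∀ j i, Measurable fun ω : Tape => shiftedCoord d κ x (fun n => ω n) j i := by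
    intro j i
    unfold shiftedCoord
    fun_prop
  have hg : ∀ j, MeasurableSet {ω : Tape |
      m ≤ j ∨ Good d Λ Q m B (shiftedCoord d κ x (fun n => ω n) j)} := by
    intro j
    refine (MeasurableSet.const _).union ?_
    have h := measurable_searchTime (Q := Q) (B := B) (hc j) d 0 (fun _ => 0) measurable_const
    have hT : MeasurableSet {n : ℕ | n * m ≤ Λ} := .of_discrete
    exact h hT
  classical
  have hf : Measurable fun ω : Tape => firstGood d Λ Q m κ B x (fun n => ω n) := by
    unfold firstGood
    exact measurable_find (fun ω : Tape => exists_good_or_le d Λ Q m κ B x (fun n => ω n)) hg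
  have he : ∀ j : ℕ, Measurable fun ω : Tape =>
      encode d (fun i => ⌊shiftedCoord d κ x (fun n => ω n) j i⌋) j := by
    intro j
    refine measurable_pi_iff.2 fun t => ?_
    unfold encode
    split_ifs
    · exact Int.measurable_floor.comp (hc j t)
    · exact measurable_const
  have : {ω : Tape | hashValue d Λ Q m κ B x (fun n => ω n) = z} =
      ⋃ j : ℕ, {ω : Tape | firstGood d Λ Q m κ B x (fun n => ω n) = j} ∩
        {ω : Tape | encode d (fun i => ⌊shiftedCoord d κ x (fun n => ω n) j i⌋) j = z} := by
    ext ω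
    simp [hashValue]
  rw [this]
  exact .iUnion fun j => (hf (measurableSet_singleton j)).inter
    (he j (measurableSet_singleton z))

theorem cellDist_floor_sq_le {u w : ℝ} : cellDist u ⌊w⌋ ^ 2 ≤ (u - w) ^ 2 := by
  have := cellDist_le_add w u ⌊w⌋
  rw [cellDist_floor, zero_add, abs_sub_comm] at this
  rw [← sq_abs (u - w)]
  exact pow_le_pow_left₀ (cellDist_nonneg _ _) this 2

/-- A point has distance at most `cellDist + 1` from all points of a cell; the bound uses
`(D + 1) ^ 2 ≤ 2 * D ^ 2 + 2`. -/
theorem sub_sq_le_cellDist (u w : ℝ) : (u - w) ^ 2 ≤ 2 * cellDist u ⌊w⌋ ^ 2 + 2 := by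
  have h1 := Int.floor_le w
  have h2 := Int.lt_floor_add_one w
  have h3 : |u - w| ≤ cellDist u ⌊w⌋ + 1 := by
    rw [abs_le]
    unfold cellDist
    constructor <;> split_ifs <;> linarith
  rw [← sq_abs]
  nlinarith [abs_nonneg (u - w), cellDist_nonneg u ⌊w⌋, sq_nonneg (cellDist u ⌊w⌋ - 1)]

/-- If every grid point has a good shift, then the hash function is an efficient hash, for any
memory content holding the parameters. -/
theorem isEfficientHash_of_good {Γ ρ T : ℝ} {b : ℕ} {seed : State} {S : ℕ → ℝ}
    (hd : seed.ints 0 0 = d) (hΛ : seed.ints 0 2 = Λ) (hQ : seed.ints 5 0 = Q)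
    (hm : seed.ints 6 0 = m) (hκ : seed.reals 2 0 = Q / max ρ (1 / 4))
    (hR : seed.reals 3 0 = Q / Γ) (hS : ∀ n < m * d, seed.reals 1 (n : ℤ) = S n)
    (hd1 : 1 ≤ d) (hdQ : (d : ℝ) ≤ (Q : ℝ) ^ 2) (hΓ : 2 < Γ) (hρ : 0 < ρ)
    (hb : ∀ x : Grid d Δ, ∀ k < m, ∀ i < d,
      Nat.size ⌊shiftedCoord d (Q / max ρ (1 / 4)) (gridCoord x) S k i⌋.natAbs ≤ b)
    (hT : ((m * (d * (60 + b) + Λ / m * (250 * (d + 1)) + 80 * (d + 1) + 210) + 80 : ℕ) : ℝ) ≤ T)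
    (hgood : ∀ x : Grid d Δ, ∃ j < m, Good d Λ Q m ((2 * (Q / Γ)) ^ 2)
      (shiftedCoord d (Q / max ρ (1 / 4)) (gridCoord x) S j)) :
    IsEfficientHash (scan (2 : ℕ)) (scan (1 : ℕ)) T Γ Λ ρ seed fun x : Grid d Δ =>
      hashValue d Λ Q m (Q / max ρ (1 / 4)) ((2 * (Q / Γ)) ^ 2) (gridCoord x) S := by
  classical
  set κ : ℝ := Q / max ρ (1 / 4) with hκdef
  set R : ℝ := Q / Γ with hRdef
  have hQpos : (0 : ℝ) < Q := by
    have : (1 : ℝ) ≤ d := by exact_mod_cast hd1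
    rcases (Nat.cast_nonneg (α := ℝ) Q).eq_or_lt with h | h
    · rw [← h] at hdQ; linarith
    · exact h
  have hmax : 0 < max ρ (1 / 4) := lt_max_of_lt_left hρ
  have hκpos : 0 < κ := by positivity
  have hR0 : 0 ≤ R := by positivity
  have hRQ : 2 * R < Q := by
    rw [hRdef, mul_div_assoc', div_lt_iff₀ (by linarith)]
    nlinarith
  have hscale : ∀ {x y : Grid d Δ} {c : ℝ}, κ * dist x y ≤ c * Q → dist x y ≤ c * max ρ (1 / 4) := by
    intro x y c h
    rw [hκdef, div_mul_eq_mul_div, div_le_iff₀ hmax] at h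
    nlinarith
  -- The first good shift of a point.
  have hfirst : ∀ x : Grid d Δ, firstGood d Λ Q m κ ((2 * R) ^ 2) (gridCoord x) S < m ∧
      Good d Λ Q m ((2 * R) ^ 2) (shiftedCoord d κ (gridCoord x) S
        (firstGood d Λ Q m κ ((2 * R) ^ 2) (gridCoord x) S)) := by
    intro x
    obtain ⟨j, hj, hg⟩ := hgood x
    have h1 : firstGood d Λ Q m κ ((2 * R) ^ 2) (gridCoord x) S ≤ j :=
      Nat.find_min' _ (Or.inr hg)
    have h2 := Nat.find_spec (exists_good_or_le d Λ Q m κ ((2 * R) ^ 2) (gridCoord x) S)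
    change m ≤ firstGood _ _ _ _ _ _ _ _ ∨ _ at h2
    exact ⟨by omega, h2.resolve_left (by omega)⟩
  have hscan : ∀ (f : ℕ) (x : Grid d Δ), f ≤ 2 → Runs (scan f) (queryState seed x)
      (m * (d * (60 + b) + Λ / m * (250 * (d + 1)) + 80 * (d + 1) + 210) + 80) fun s' =>
      ValueRep d Λ Q m κ ((f * R) ^ 2) (gridCoord x) S m s' ∧ ∃ L : List (Fin (d + 1) → ℤ),
        s'.outSet d = L.toFinset ∧ ListSpec d Λ Q m κ ((f * R) ^ 2) (gridCoord x) S m L := by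
    intro f x hf
    refine scan_runs hd hΛ hQ hm (fun i hi => ?_) hS hκ hR hd1 hR0 ?_ (hb x)
    · simp [queryState, gridCoord, hi]
    · have : (f : ℝ) ≤ 2 := by exact_mod_cast hf
      nlinarith
  -- Points of the same cell differ by less than one cell width in each coordinate.
  have hdiam : ∀ x y : Grid d Δ,
      hashValue d Λ Q m κ ((2 * R) ^ 2) (gridCoord x) S =
        hashValue d Λ Q m κ ((2 * R) ^ 2) (gridCoord y) S → dist x y ≤ ρ := by
    intro x y h
    obtain ⟨h1, h2⟩ := encode_inj h
    have h2 : firstGood d Λ Q m κ ((2 * R) ^ 2) (gridCoord x) S =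
      firstGood d Λ Q m κ ((2 * R) ^ 2) (gridCoord y) S := by exact_mod_cast h2
    rw [h2] at h1
    have h3 := sum_sq_shiftedCoord κ S (firstGood d Λ Q m κ ((2 * R) ^ 2) (gridCoord y) S) x y
    have h4 : (κ * dist x y) ^ 2 ≤ (1 * (Q : ℝ)) ^ 2 := by
      rw [← h3, one_mul]
      refine le_trans (Finset.sum_le_card_nsmul _ _ 1 fun i hi => ?_) (by simpa using hdQ)
      have := Int.abs_sub_lt_one_of_floor_eq_floor (h1 i (Finset.mem_range.1 hi))
      rw [← sq_abs]
      nlinarith [abs_nonneg (shiftedCoord d κ (gridCoord x) S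
        (firstGood d Λ Q m κ ((2 * R) ^ 2) (gridCoord y) S) i - shiftedCoord d κ (gridCoord y) S
        (firstGood d Λ Q m κ ((2 * R) ^ 2) (gridCoord y) S) i)]
    have h5 := hscale (abs_le_of_sq_le_sq' h4 (by positivity)).2
    simpa using dist_le_of_le_max zero_le_one one_le_two hρ h5
  -- The listed cells have distance at most `R` from `x`, and a cell has diameter at most `Q`.
  have hrange : ∀ x : Grid d Δ, ∃ (s : State) (t : ℕ),
      Exec (scan (1 : ℕ)) (queryState seed x) s t ∧ (t : ℝ) ≤ T ∧ (s.outSet d).card ≤ Λ ∧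
      (fun x : Grid d Δ => hashValue d Λ Q m κ ((2 * R) ^ 2) (gridCoord x) S) ''
        Metric.closedBall x (ρ / Γ) ⊆ ↑(s.outSet d) ∩ Set.range (fun x : Grid d Δ =>
          hashValue d Λ Q m κ ((2 * R) ^ 2) (gridCoord x) S) ∧
      ↑(s.outSet d) ∩ Set.range (fun x : Grid d Δ =>
        hashValue d Λ Q m κ ((2 * R) ^ 2) (gridCoord x) S) ⊆
        (fun x : Grid d Δ => hashValue d Λ Q m κ ((2 * R) ^ 2) (gridCoord x) S) ''
          Metric.closedBall x (2 * ρ) := by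
    intro x
    obtain ⟨s, t, he, ht, -, L, hL, hspec⟩ := hscan 1 x (by norm_num)
    rw [Nat.cast_one, one_mul] at hspec
    refine ⟨s, t, he, le_trans (by exact_mod_cast ht) hT, ?_, ?_, ?_⟩
    · rw [hL]
      exact (L.toFinset_card_le).trans (hspec.length_le.trans (Nat.mul_div_le Λ m))
    · rintro _ ⟨y, hy, rfl⟩
      refine ⟨?_, y, rfl⟩
      have hsum := sum_sq_shiftedCoord κ S
        (firstGood d Λ Q m κ ((2 * R) ^ 2) (gridCoord y) S) x y
      have hle : (κ * dist x y) ^ 2 ≤ R ^ 2 := by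
        refine pow_le_pow_left₀ (by positivity) ?_ 2
        rw [dist_comm]
        calc κ * dist y x ≤ κ * (max ρ (1 / 4) / Γ) := by
              gcongr
              exact (Metric.mem_closedBall.1 hy).trans (by gcongr; exact le_max_left _ _)
          _ = R := by rw [hκdef, hRdef]; field_simp
      obtain ⟨hlt, hg⟩ := hfirst y
      rw [hL, Finset.mem_coe, List.mem_toFinset]
      refine hspec.complete _ hlt ?_ _ ?_
      -- The shift is good for `y` at radius `2 * R`, hence for `x` at radius `R`.
      · refine le_trans (Nat.mul_le_mul_right m ?_) hg
        exact searchTime_le_searchTime hR0 hRQ (hsum.le.trans hle) d 0 0 0 (by omega) le_rfl le_rfl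
          (by simp)
      · exact (Finset.sum_le_sum fun i _ => cellDist_floor_sq_le).trans (hsum.le.trans hle)
    · rintro z ⟨hz, y, rfl⟩
      refine ⟨y, ?_, rfl⟩
      rw [hL, Finset.mem_coe, List.mem_toFinset] at hz
      obtain ⟨i, hi, v, hv, hsum⟩ := hspec.sound _ hz
      obtain ⟨h1, h2⟩ := encode_inj hv
      have h2 : firstGood d Λ Q m κ ((2 * R) ^ 2) (gridCoord y) S = i := by exact_mod_cast h2
      rw [h2] at h1
      have h3 : (κ * dist x y) ^ 2 ≤ (2 * (Q : ℝ)) ^ 2 := by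
        rw [← sum_sq_shiftedCoord κ S i x y]
        have h4 := Finset.sum_le_sum fun n (_ : n ∈ Finset.range d) =>
          sub_sq_le_cellDist (shiftedCoord d κ (gridCoord x) S i n)
            (shiftedCoord d κ (gridCoord y) S i n)
        rw [Finset.sum_add_distrib, ← Finset.mul_sum] at h4
        have h5 : ∑ n ∈ Finset.range d, cellDist (shiftedCoord d κ (gridCoord x) S i n)
            ⌊shiftedCoord d κ (gridCoord y) S i n⌋ ^ 2 ≤ R ^ 2 := by
          refine le_trans (le_of_eq (Finset.sum_congr rfl fun n hn => ?_)) hsum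
          rw [h1 n (Finset.mem_range.1 hn)]
        simp only [Finset.sum_const, Finset.card_range, nsmul_eq_mul] at h4
        nlinarith
      have h5 := hscale (abs_le_of_sq_le_sq' h3 (by positivity)).2
      rw [Metric.mem_closedBall, dist_comm]
      exact dist_le_of_le_max zero_le_two le_rfl hρ h5
  refine ⟨⟨?_, ?_⟩, ?_, hrange⟩
  · intro z _
    refine Metric.diam_le_of_forall_dist_le hρ.le fun x hx y hy => hdiam x y ?_
    exact hx.trans hy.symm
  -- Consistency follows from the existence of the answer to a range query.
  · intro x
    obtain ⟨s, t, -, -, hcard, hsub, -⟩ := hrange x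
    refine (Set.encard_le_encard (hsub.trans Set.inter_subset_left)).trans ?_
    rw [Set.encard_coe_eq_coe_finsetCard]
    exact_mod_cast hcard
  · intro x
    obtain ⟨s, t, he, ht, hV, -⟩ := hscan 2 x le_rfl
    refine ⟨s, t, he, le_trans (by exact_mod_cast ht) hT, ?_⟩
    rw [Nat.cast_ofNat] at hV
    obtain ⟨hlt, hg⟩ := hfirst x
    rcases hV with ⟨-, h⟩ | ⟨-, J, hJ, hgJ, hmin, hout⟩
    · exact absurd hg (h _ hlt)
    · have : firstGood d Λ Q m κ ((2 * R) ^ 2) (gridCoord x) S = J := by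
        apply le_antisymm
        · exact Nat.find_min' _ (Or.inr hgJ)
        · by_contra hlt'
          exact hmin _ (not_le.1 hlt') hg
      rw [hout, hashValue, this]

end RealRAM

/-! ### The probability of failure and the running times -/

namespace RealRAM
open CellSearch

theorem ceil_sqrt_le {d : ℕ} (hd : 1 ≤ d) :
    ((⌈√(d : ℝ)⌉₊ : ℕ) : ℝ) ≤ 2 * √d ∧ ⌈√(d : ℝ)⌉₊ ≤ d ∧ (d : ℝ) ≤ (⌈√(d : ℝ)⌉₊ : ℝ) ^ 2 := by
  have h1 : (1 : ℝ) ≤ √d := Real.one_le_sqrt.2 (by exact_mod_cast hd)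
  have h2 := Nat.le_ceil √(d : ℝ)
  have h3 := Nat.ceil_lt_add_one (Real.sqrt_nonneg (d : ℝ))
  have h4 := Real.sq_sqrt (Nat.cast_nonneg (α := ℝ) d)
  refine ⟨by linarith, Nat.ceil_le.2 (by nlinarith), ?_⟩
  nlinarith

theorem clog_le {Δ : ℕ} (hΔ : 2 ≤ Δ) :
    1 ≤ Real.logb 2 Δ ∧ (Nat.clog 2 Δ : ℝ) ≤ 2 * Real.logb 2 Δ := by
  have h1 : 1 ≤ Real.logb 2 Δ := by
    rw [Real.le_logb_iff_rpow_le one_lt_two (by positivity), Real.rpow_one]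
    exact_mod_cast hΔ
  have h2 : (Nat.clog 2 Δ : ℝ) < Real.logb 2 Δ + 1 := by
    have := Nat.ceil_lt_add_one (zero_le_one.trans h1)
    rwa [← Nat.cast_ofNat (R := ℝ), Real.natCeil_logb_natCast, Nat.cast_ofNat] at this
  exact ⟨h1, by linarith⟩

/-- The bound for the expected number of cells within distance `2 * R` of a point. The parameter of
the Gaussian weights balances the two factors. -/
theorem exp_mul_pow_le {d q : ℕ} {Γ : ℝ} (hΓ : 0 < Γ) (hq : (q : ℝ) ≤ 2 * √d) :
    Real.exp (Γ ^ (4 / 3 : ℝ) * (2 * (q / Γ)) ^ 2) *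
      (1 + 2 * √(Real.pi / Γ ^ (4 / 3 : ℝ))) ^ d ≤ 2 ^ (40 * ((d : ℝ) / Γ ^ (2 / 3 : ℝ))) := by
  set g := Γ ^ (2 / 3 : ℝ) with hg
  have hg0 : 0 < g := Real.rpow_pos_of_pos hΓ _
  -- In terms of `g`, the two factors are at most `exp (16 * d / g)` and `exp (4 * d / g)`.
  have h43 : Γ ^ (4 / 3 : ℝ) = g ^ 2 := by
    rw [hg, ← Real.rpow_natCast, ← Real.rpow_mul hΓ.le]; norm_num
  have h3 : Γ ^ 2 = g ^ 3 := by
    rw [hg, ← Real.rpow_natCast (Γ ^ (2 / 3 : ℝ)), ← Real.rpow_mul hΓ.le, ← Real.rpow_natCast]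
    norm_num
  have hB : g ^ 2 * (2 * (q / Γ)) ^ 2 ≤ 16 * (d / g) := by
    have hq2 : (q : ℝ) ^ 2 ≤ 4 * d := by
      calc (q : ℝ) ^ 2 ≤ (2 * √d) ^ 2 := pow_le_pow_left₀ (Nat.cast_nonneg _) hq 2
        _ = 4 * d := by rw [mul_pow, Real.sq_sqrt (Nat.cast_nonneg _)]; norm_num
    rw [mul_pow, div_pow, h3]
    calc g ^ 2 * (2 ^ 2 * ((q : ℝ) ^ 2 / g ^ 3)) = 4 * (q : ℝ) ^ 2 / g := by field_simp; ring
      _ ≤ 4 * (4 * d) / g := by gcongr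
      _ = 16 * (d / g) := by ring
  have hw : √(Real.pi / g ^ 2) ≤ 2 / g := by
    rw [Real.sqrt_div Real.pi_pos.le, Real.sqrt_sq hg0.le]
    gcongr
    rw [Real.sqrt_le_left zero_le_two]
    linarith [Real.pi_le_four]
  have hpow : (1 + 2 * √(Real.pi / g ^ 2)) ^ d ≤ Real.exp (4 * (d / g)) := by
    calc (1 + 2 * √(Real.pi / g ^ 2)) ^ d ≤ Real.exp (4 / g) ^ d := by
          gcongr
          refine le_trans ?_ (Real.add_one_le_exp _)
          have : 2 * (2 / g) = 4 / g := by ring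
          linarith
      _ = Real.exp (4 * (d / g)) := by rw [← Real.exp_nat_mul]; congr 1; ring
  rw [h43]
  calc _ ≤ Real.exp (16 * (d / g)) * Real.exp (4 * (d / g)) := by gcongr
    _ = Real.exp (20 * (d / g)) := by rw [← Real.exp_add]; congr 1; ring
    _ ≤ Real.exp (Real.log 2 * (40 * (d / g))) := by
        apply Real.exp_le_exp.2
        have : 0 ≤ (d : ℝ) / g := by positivity
        nlinarith [Real.log_two_gt_d9]
    _ = _ := by rw [← Real.rpow_def_of_pos two_pos]

/-- The bit length of the integer parts is linear in `d` and `log Δ`, because the cell width is at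
least `1 / (4 * q)`. -/
theorem size_floor_le {d Δ L q : ℕ} {ρ : ℝ} {S : ℕ → ℝ} (hS : ∀ n, S n ∈ Set.Icc (0 : ℝ) 1)
    (hL : Δ ≤ 2 ^ L) (hq : q ≤ d) (x : Grid d Δ) (k i : ℕ) (hi : i < d) :
    Nat.size ⌊shiftedCoord d (q / max ρ (1 / 4)) (gridCoord x) S k i⌋.natAbs ≤ L + d + 3 := by
  rw [Nat.size_le]
  set κ : ℝ := q / max ρ (1 / 4)
  have hκ0 : 0 ≤ κ := by
    have : (0 : ℝ) < max ρ (1 / 4) := lt_max_of_lt_right (by norm_num)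
    positivity
  have hκ : κ ≤ 4 * q := by
    rw [div_le_iff₀ (lt_max_of_lt_right (by norm_num))]
    nlinarith [le_max_right ρ (1 / 4), Nat.cast_nonneg (α := ℝ) q]
  have hx := x.2 ⟨i, hi⟩
  have hx0 : (0 : ℝ) ≤ gridCoord x i := by
    simp only [gridCoord, hi, dif_pos]; exact_mod_cast (by omega : (0 : ℤ) ≤ x.1 ⟨i, hi⟩)
  have hxΔ : (gridCoord x i : ℝ) ≤ 2 ^ L := by
    have h1 : (gridCoord x i : ℝ) ≤ Δ := by
      simp only [gridCoord, hi, dif_pos]; exact_mod_cast hx.2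
    exact h1.trans (by exact_mod_cast hL)
  have hqd : (q : ℝ) ≤ 2 ^ d := by exact_mod_cast hq.trans Nat.lt_two_pow_self.le
  obtain ⟨hs0, hs1⟩ := hS (k * d + i)
  have h0 : 0 ≤ shiftedCoord d κ (gridCoord x) S k i := by
    unfold shiftedCoord; positivity
  have h1 : shiftedCoord d κ (gridCoord x) S k i < 2 ^ (L + d + 3) := by
    unfold shiftedCoord
    have h2 : (gridCoord x i : ℝ) * κ ≤ 2 ^ L * (4 * 2 ^ d) :=
      mul_le_mul hxΔ (hκ.trans (by gcongr)) hκ0 (by positivity)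
    have h3 : (1 : ℝ) ≤ 2 ^ L * 2 ^ d :=
      one_le_mul_of_one_le_of_one_le (one_le_pow₀ one_le_two) (one_le_pow₀ one_le_two)
    rw [pow_add, pow_add]
    nlinarith
  have h2 : (⌊shiftedCoord d κ (gridCoord x) S k i⌋.natAbs : ℤ) < 2 ^ (L + d + 3) := by
    rw [Int.natAbs_of_nonneg (Int.floor_nonneg.2 h0), Int.floor_lt]
    exact_mod_cast h1
  exact_mod_cast h2

/-- The union bound over the grid points. -/
theorem tapeMeasure_exists_forall_not_good_le {d Δ Λ Q m e : ℕ} {κ B lam : ℝ} (hlam : 0 < lam)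
    (hB : 0 ≤ B) (hΛ : 0 < Λ)
    (h : 2 * (m * ((d * (2 * Q + 2) + 1) * (Real.exp (lam * B) *
      (1 + 2 * √(Real.pi / lam)) ^ d))) ≤ (Λ : ℝ)) (hΔ : 2 ≤ Δ)
    (hm : m = d * (Nat.clog 2 Δ * (e + 1))) :
    tapeMeasure {ω : Tape | ∃ x : Grid d Δ, ∀ j < m,
      ¬ Good d Λ Q m B (shiftedCoord d κ (gridCoord x) (fun n => ω n) j)} ≤
      ENNReal.ofReal (1 / ((Δ : ℝ) ^ d) ^ e) := by
  have hset : {ω : Tape | ∃ x : Grid d Δ, ∀ j < m,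
      ¬ Good d Λ Q m B (shiftedCoord d κ (gridCoord x) (fun n => ω n) j)} =
      ⋃ x : Grid d Δ, {ω : Tape | ∀ j < m,
        Λ < searchTime Q B (fun k => gridCoord x k * κ + ω (j * d + k)) d 0 0 * m} := by
    ext ω
    simp only [Set.mem_ofPred_eq, Set.mem_iUnion, Good, not_le]
    exact Iff.rfl
  rw [hset]
  refine (measure_iUnion_fintype_le _ _).trans ((Finset.sum_le_sum fun x _ =>
    tapeMeasure_forall_lt_searchTime_le hlam hB hΛ h fun k => gridCoord x k * κ).trans ?_)
  rw [Finset.sum_const, nsmul_eq_mul, ← ENNReal.ofReal_pow (by norm_num),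
    ← ENNReal.ofReal_natCast, ← ENNReal.ofReal_mul (by positivity)]
  apply ENNReal.ofReal_le_ofReal
  have hΔ0 : (0 : ℝ) < Δ := by positivity
  have h1 : (Fintype.card (Grid d Δ) : ℝ) ≤ (Δ : ℝ) ^ d := by exact_mod_cast card_grid_le
  have h2 : ((Δ : ℝ) ^ d) ^ (e + 1) ≤ 2 ^ m := by
    have h3 : (Δ : ℝ) ≤ 2 ^ Nat.clog 2 Δ := by exact_mod_cast Nat.le_pow_clog one_lt_two Δ
    calc ((Δ : ℝ) ^ d) ^ (e + 1) ≤ ((2 ^ Nat.clog 2 Δ) ^ d) ^ (e + 1) := by gcongr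
      _ = 2 ^ m := by rw [hm, ← pow_mul, ← pow_mul]; congr 1; ring
  rw [one_div, inv_pow, ← div_eq_mul_inv, div_le_div_iff₀ (by positivity) (by positivity), one_mul]
  calc _ ≤ (Δ : ℝ) ^ d * ((Δ : ℝ) ^ d) ^ e := by gcongr; exact h1
    _ = ((Δ : ℝ) ^ d) ^ (e + 1) := by ring
    _ ≤ _ := h2

end RealRAM

theorem mainTheorem3 :
    ∃ c : ℝ, 0 < c ∧ ∀ e : ℕ,
      ∃ (sampleProg evalProg rangeProg : RealRAM.Cmd) (A : ℝ) (k : ℕ), 0 < A ∧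
        ∀ (d Δ Λ : ℕ) (Γ ρ : ℝ), 1 ≤ d → 2 ≤ Δ → 2 * √(2 * Real.pi) ≤ Γ → 0 < ρ →
          (2 : ℝ) ^ (c * ((d : ℝ) / Γ ^ (2 / 3 : ℝ))) * (A * ((d : ℝ) * Real.logb 2 Δ) ^ k)
            ≤ (Λ : ℝ) →
          ∃ (seed : RealRAM.Tape → RealRAM.State)
            (φ : RealRAM.Tape → Grid d Δ → Fin (d + 1) → ℤ),
            (∀ ω : RealRAM.Tape, ∃ t : ℕ,
              RealRAM.Exec sampleProg (RealRAM.startState d Δ Λ Γ ρ ω) (seed ω) t ∧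
                (t : ℝ) ≤ A * ((d : ℝ) * Real.logb 2 Δ) ^ k) ∧
            (∀ (x : Grid d Δ) (z : Fin (d + 1) → ℤ),
              MeasurableSet {ω : RealRAM.Tape | φ ω x = z}) ∧
            RealRAM.tapeMeasure {ω : RealRAM.Tape |
                ¬ RealRAM.IsEfficientHash evalProg rangeProg
                  ((Λ : ℝ) * (A * ((d : ℝ) * Real.logb 2 Δ) ^ k)) Γ Λ ρ (seed ω) (φ ω)}
              ≤ ENNReal.ofReal (1 / ((Δ : ℝ) ^ d) ^ e) := by
  refine ⟨40, by norm_num, fun e => ⟨RealRAM.sample e, RealRAM.scan (2 : ℕ), RealRAM.scan (1 : ℕ),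
    4000 * (e + 1), 3, by positivity, ?_⟩⟩
  intro d Δ Λ Γ ρ hd hΔ hΓ hρ hΛ
  have hΓ2 : 2 < Γ := by
    have : (1 : ℝ) < √(2 * Real.pi) := by
      rw [Real.lt_sqrt zero_le_one]
      linarith [Real.pi_gt_three]
    linarith
  set q := ⌈√(d : ℝ)⌉₊ with hq
  set L := Nat.clog 2 Δ with hL
  obtain ⟨m, hm⟩ : ∃ m, m = d * (L * (e + 1)) := ⟨_, rfl⟩
  obtain ⟨hq1, hqd, hdq⟩ := RealRAM.ceil_sqrt_le hd
  obtain ⟨hlog, hLlog⟩ := RealRAM.clog_le hΔ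
  have hd1 : (1 : ℝ) ≤ d := by exact_mod_cast hd
  have hqd' : (q : ℝ) ≤ d := by exact_mod_cast hqd
  have he : (1 : ℝ) ≤ e + 1 := by
    have := Nat.cast_nonneg (α := ℝ) e
    linarith
  set E : ℝ := e + 1 with hE
  set X : ℝ := d * Real.logb 2 Δ with hX
  have hdX : (d : ℝ) ≤ X := le_mul_of_one_le_right (by linarith) hlog
  have hX1 : 1 ≤ X := hd1.trans hdX
  have hLX : (L : ℝ) ≤ 2 * X := by
    refine hLlog.trans ?_
    rw [hX]
    nlinarith
  have hmX : (m : ℝ) ≤ 2 * E * X := by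
    rw [hm]
    push_cast
    calc (d : ℝ) * (L * (e + 1)) ≤ d * (2 * Real.logb 2 Δ * (e + 1)) := by gcongr
      _ = 2 * E * X := by rw [hE, hX]; ring
  have hX2 : X ≤ X ^ 2 := by nlinarith
  have hX3 : X ^ 2 ≤ X ^ 3 := by nlinarith [sq_nonneg X]
  -- All running times are bounded by multiples of `E * X ^ 3`.
  have hEX : X ^ 3 ≤ E * X ^ 3 := le_mul_of_one_le_left (by positivity) he
  have hEX3 : 1 ≤ E * X ^ 3 := by linarith
  have hmd : (m : ℝ) * d ≤ 2 * (E * X ^ 2) := by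
    calc (m : ℝ) * d ≤ (2 * E * X) * X := by gcongr
      _ = _ := by ring
  have hEX23 : E * X ^ 2 ≤ E * X ^ 3 := by gcongr
  have hEX12 : E * X ≤ E * X ^ 2 := by gcongr
  have hone : (1 : ℝ) ≤ 2 ^ (40 * ((d : ℝ) / Γ ^ (2 / 3 : ℝ))) :=
    Real.one_le_rpow one_le_two (by positivity)
  have hΛpos : 0 < Λ := by
    have : (0 : ℝ) < Λ := lt_of_lt_of_le (by positivity) hΛ
    exact_mod_cast this
  have hΛ1 : (1 : ℝ) ≤ Λ := by exact_mod_cast hΛpos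
  have hsample := fun ω => RealRAM.sample_runs d Δ Λ e Γ ρ ω hm
  choose seed time hexec htime s1 s2 s3 s4 s5 s6 s7 using hsample
  refine ⟨seed, fun ω x => RealRAM.hashValue d Λ q m (q / max ρ (1 / 4)) ((2 * (q / Γ)) ^ 2)
    (CellSearch.gridCoord x) (fun n => ω n), fun ω => ⟨time ω, hexec ω, ?_⟩,
    fun x z => RealRAM.measurableSet_hashValue_eq _ _ _ _ _ _ _ z, ?_⟩
  · have h1 : (time ω : ℝ) ≤ q * 30 + L * 40 + d * 40 + m * 40 + m * d * 40 + 160 := by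
      exact_mod_cast htime ω
    nlinarith
  · have hcount : 2 * (m * ((d * (2 * q + 2) + 1) * (Real.exp (Γ ^ (4 / 3 : ℝ) *
        (2 * (q / Γ)) ^ 2) * (1 + 2 * √(Real.pi / Γ ^ (4 / 3 : ℝ))) ^ d))) ≤ (Λ : ℝ) := by
      have hK : (d : ℝ) * (2 * q + 2) + 1 ≤ 5 * X ^ 2 := by nlinarith
      calc _ ≤ 2 * ((2 * E * X) * ((5 * X ^ 2) * 2 ^ (40 * ((d : ℝ) / Γ ^ (2 / 3 : ℝ))))) := by
            gcongr
            exact RealRAM.exp_mul_pow_le (by linarith) hq1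
        _ = 2 ^ (40 * ((d : ℝ) / Γ ^ (2 / 3 : ℝ))) * (20 * (E * X ^ 3)) := by ring
        _ ≤ 2 ^ (40 * ((d : ℝ) / Γ ^ (2 / 3 : ℝ))) * (4000 * E * X ^ 3) := by
            refine mul_le_mul_of_nonneg_left ?_ (by positivity)
            linarith
        _ ≤ Λ := hΛ
    refine le_trans (measure_mono fun ω hω => ?_)
      (RealRAM.tapeMeasure_exists_forall_not_good_le (κ := q / max ρ (1 / 4))
        (Real.rpow_pos_of_pos (by linarith : 0 < Γ) (4 / 3)) (sq_nonneg _) hΛpos hcount hΔ hm)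
    by_contra hgood
    simp only [Set.mem_ofPred_eq, not_exists, not_forall, not_not] at hgood
    refine hω (RealRAM.isEfficientHash_of_good (b := L + d + 3) (s1 ω) (s2 ω) (s3 ω) (s4 ω) (s5 ω)
      (s6 ω) (s7 ω) hd hdq hΓ2 hρ (fun x k _ i hi => RealRAM.size_floor_le (fun n => (ω n).2)
      (Nat.le_pow_clog one_lt_two Δ) hqd x k i hi) ?_ fun x => ?_)
    · have hdiv : ((m * (Λ / m) : ℕ) : ℝ) ≤ Λ := by exact_mod_cast Nat.mul_div_le Λ m
      push_cast at hdiv ⊢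
      set y : ℝ := ((Λ / m : ℕ) : ℝ)
      have t1 : (m : ℝ) * d * (63 + L + d) ≤ 132 * (E * X ^ 3) := by
        calc (m : ℝ) * d * (63 + L + d) ≤ 2 * (E * X ^ 2) * (66 * X) := by
              gcongr
              linarith
          _ = _ := by ring
      have t2 : (m : ℝ) * y * (250 * (d + 1)) ≤ Λ * (500 * (E * X ^ 3)) :=
        mul_le_mul hdiv (by linarith) (by positivity) (by positivity)
      have t3 : (E * X ^ 3 : ℝ) ≤ Λ * (E * X ^ 3) := le_mul_of_one_le_left (by positivity) hΛ1
      linarith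
    · obtain ⟨j, hj, hg⟩ := hgood x
      exact ⟨j, hj, hg⟩
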